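/- Let $T>0$ and $M\in\mathbb R$. All functions are real valued. For $0<s<1$ put $C_s=\dfrac{s\,2^{2s}\,\Gamma(\frac{1+2s}{2})}{\sqrt\pi\,\Gamma(1-s)}$, $$\mathcal E(v,w)=\frac{C_s}{2}\int_{\mathbb R}\int_{\mathbb R}\frac{(v(x)-v(y))(w(x)-w(y))}{|x-y|^{1+2s}}\,dx\,dy ,$$ and let $H_0^s$ be the space of all $v\in L^2(\mathbb R)$ with $v=0$ a.e. outside $(-1,1)$ and $\mathcal E(v,v)<\infty$, with the norm $\|v\|_{H_0^s}=\mathcal E(v,v)^{1/2}$; it is regarded as a subspace of $L^2(-1,1)$. (If $(-d_x^2)^s_D$ denotes the self-adjoint operator on $L^2(-1,1)$ associated with $\mathcal E$, $(\rho_n)$ its eigenvalues and $(e_n)$ an orthonormal basis of eigenfunctions, then $H_0^s$ is the domain of its square root and $\|v\|_{H_0^s}^2=\sum_n\rho_n|(v,e_n)|^2$.) For $c\in\mathbb R$ and a non-empty open set $\omega_0\subset(-1,1)$ let $\omega(t)=\omega_0-ct$ and $\mathcal O=\{(t,x):0<t<T,\ x\in\omega(t)\}$. **Theorem.** There is a constant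 $\mathcal C>0$ depending only on $T$ and $M$ such that the following holds for all $0<s<1$, all $c\in\mathbb R$ and all non-empty open $\omega_0\subset(-1,1)$. For all $(y^0,y^1)\in H_0^s\times L^2(-1,1)$ and $u\in L^2(\mathcal O)$, the problem $$\begin{cases} y_{tt}+(-d_x^2)^s y-M\displaystyle\int_0^t(-d_x^2)^s y(\tau)\,d\tau=\mathbf 1_{\omega(t)}u & \text{in }(0,T)\times(-1,1),\\ y=0 & \text{in }(0,T)\times(\mathbb R\setminus(-1,1)),\\ y(0)=y^0,\quad y_t(0)=y^1 & \text{in }(-1,1)\end{cases}$$ has a unique solution $y\in C([0,T];H_0^s)\cap C^1([0,T];L^2(-1,1))$, and $$\|y(t)\|_{H_0^s}+\|y(t)\|_{L^2(-1,1)}+\|y_t(t)\|_{L^2(-1,1)}\le\mathcal C\left(\|y^0\|_{H_0^s}+\|y^1\|_{L^2(-1,1)}+\|u\|_{L^2(\mathcal O)}\right)\qquad(0\le t\le T).$$ Here a solution is a function $y$ in this class with $y(0)=y^0$, $y_t(0)=y^1$ that satisfies the equation in the dual of $H_0^s$: for every $v\in H_0^s$ and every $t\in[0,T]$, $$(y_t(t),v)_{L^2(-1,1)}=(y^1,v)_{L^2(-1,1)}+\int_0^t\Big(-\mathcal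 E(y(\tau),v)+M\int_0^\tau\mathcal E(y(r),v)\,dr+\int_{(-1,1)}\mathbf 1_{\omega(\tau)}(x)\,u(\tau,x)\,v(x)\,dx\Big)\,d\tau .$$ -/

import Mathlib

open MeasureTheory Set Filter Topology

noncomputable section

namespace FracWave

/-- The space domain `(-1,1)`. -/
abbrev dom : Set ℝ := Ioo (-1) 1

/-- The Hilbert space `L²(-1,1)` of real functions. -/
abbrev L2 : Type := Lp ℝ 2 ((volume : Measure ℝ).restrict dom)

/-- Extension by zero outside `(-1,1)`: the exterior condition `v = 0` in `ℝ ∖ (-1,1)`. -/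
def zeroExt (v : L2) : ℝ → ℝ := dom.indicator v

/-- The normalization constant `C_s = s 2^{2s} Γ((1+2s)/2) / (√π Γ(1-s))`. -/
def normConst (s : ℝ) : ℝ :=
  s * (2 : ℝ) ^ (2 * s) * Real.Gamma ((1 + 2 * s) / 2) / (√Real.pi * Real.Gamma (1 - s))

/-- The Sobolev space `H_0^s` of the functions in `H^s(ℝ)` that vanish outside `(-1,1)`, as a
subset of `L²(-1,1)`: the extension by zero has finite Gagliardo seminorm over `ℝ × ℝ`. -/
def H0s (s : ℝ) : Set L2 :=
  {v | Integrable (fun p : ℝ × ℝ =>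
    (zeroExt v p.1 - zeroExt v p.2) ^ 2 / |p.1 - p.2| ^ (1 + 2 * s)) volume}

/-- The bilinear form of the fractional Laplacian with zero exterior condition,
`𝓔(v,w) = (C_s/2) ∫∫ (v(x)-v(y)) (w(x)-w(y)) / |x-y|^{1+2s} dx dy`; the integral converges
absolutely for `v w ∈ H_0^s`. -/
def form (s : ℝ) (v w : L2) : ℝ :=
  normConst s / 2 * ∫ p : ℝ × ℝ,
    (zeroExt v p.1 - zeroExt v p.2) * (zeroExt w p.1 - zeroExt w p.2) / |p.1 - p.2| ^ (1 + 2 * s)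

/-- The norm `𝓔(v,v)^{1/2}` of `H_0^s`. -/
def energyNorm (s : ℝ) (v : L2) : ℝ := √(form s v v)

/-- `y ∈ C([0,T]; H_0^s)`. -/
def ContinuousInEnergy (s T : ℝ) (y : ℝ → L2) : Prop :=
  (∀ t ∈ Icc 0 T, y t ∈ H0s s) ∧
  ∀ t₀ ∈ Icc 0 T, Tendsto (fun t => energyNorm s (y t - y t₀)) (𝓝[Icc 0 T] t₀) (𝓝 0)

/-- The moving set `ω(t) = ω₀ - c t`. -/
def movingSet (ω₀ : Set ℝ) (c t : ℝ) : Set ℝ := {x | x + c * t ∈ ω₀}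

/-- The region `𝒪 = {(t,x) : t ∈ (0,T), x ∈ ω(t)}`. -/
def controlRegion (T : ℝ) (ω₀ : Set ℝ) (c : ℝ) : Set (ℝ × ℝ) :=
  {p | p.1 ∈ Ioo 0 T ∧ p.2 ∈ movingSet ω₀ c p.1}

/-- The space `L²(𝒪)` of controls. -/
abbrev Control (T : ℝ) (ω₀ : Set ℝ) (c : ℝ) : Type :=
  Lp ℝ 2 ((volume : Measure (ℝ × ℝ)).restrict (controlRegion T ω₀ c))

/-- The time derivative `y_t` on `[0,T]` (one-sided at the end points). -/
def timeDeriv (T : ℝ) (y : ℝ → L2) (t : ℝ) : L2 := derivWithin y (Icc 0 T) t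

/-- `y ∈ C([0,T]; H_0^s) ∩ C¹([0,T]; L²(-1,1))` solves
`y_tt + (-d_x²)^s y - M ∫_0^t (-d_x²)^s y(τ) dτ = 1_{ω(t)} u` in `(0,T) × (-1,1)`,
`y = 0` outside `(-1,1)`, `y(0) = y⁰`, `y_t(0) = y¹`.
The equation is meant in the dual of `H_0^s`, integrated once in time: for each `v ∈ H_0^s` the
function `t ↦ (y_t(t), v)` is absolutely continuous with derivative
`-𝓔(y(t),v) + M ∫_0^t 𝓔(y(τ),v) dτ + ∫_{(-1,1)} 1_{ω(t)} u(t) v dx` for almost every `t`. -/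
structure IsSolution (s T M c : ℝ) (ω₀ : Set ℝ) (y₀ y₁ : L2) (u : Control T ω₀ c)
    (y : ℝ → L2) : Prop where
  energy : ContinuousInEnergy s T y
  smooth : ContDiffOn ℝ 1 y (Icc 0 T)
  init : y 0 = y₀
  initDeriv : timeDeriv T y 0 = y₁
  weak : ∀ v ∈ H0s s, ∀ t ∈ Icc 0 T,
    inner ℝ (timeDeriv T y t) v = inner ℝ y₁ v +
      ∫ τ in (0 : ℝ)..t, (-form s (y τ) v + M * (∫ r in (0 : ℝ)..τ, form s (y r) v) +
        ∫ x in dom, (movingSet ω₀ c τ).indicator (fun z => u (τ, z)) x * v x)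

end FracWave

end

/-!
The equation is a second order evolution equation whose stiffness form is the inner product of
`H_0^s`. Write `S` for the embedding of `H_0^s`, with the norm given by the form, into `L²(-1,1)`.
It is compact, injective and has dense range, so it is diagonal in suitable Hilbert bases:
`S gᵢ = σᵢ eᵢ` with `σᵢ > 0` (`exists_singular_value_decomposition`). With `rᵢ = σᵢ⁻¹`,
`aᵢ = (y, gᵢ)` in `H_0^s` and `wᵢ = (y_t, eᵢ)` in `L²`, a solution is the same thing as a family of
solutions of the scalar systems `a' = r w`, `w' = -r a + M r ∫ a + f` (`IsMode`).

The memory term carries the unbounded factor `r`. It disappears with the unknown `p = a - M ∫ a`: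
the triple `(∫ a, p, w)` solves `z' = p + M z`, `p' = r w - M p - M² z`, `w' = -r p + f`, where `r`
enters only through a skew-symmetric matrix. Hence the energy `z² + p² + w²` grows at a rate that
depends on `M` alone (`IsMode.sq_add_sq_le`), uniformly in the mode, in `s` and in the control
region. Each mode is solvable by Duhamel's formula (`exists_isMode`); the uniform bound makes the
series of the modes converge in the right spaces (`exists_isWeakSolution`), gives the estimate
(`IsWeakSolution.sq_norm_add_le`), and with zero data gives uniqueness (`IsWeakSolution.eqOn`).

The bound on `‖y‖` in `L²` needs a Poincaré inequality with a constant that does not depend on `s`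
(`exists_poincare`). Let `g h` be the squared `L²` distance of `v` from its translate by `h`. It is
at least `‖v‖²` once `h ≥ 2`, and `g (n h) ≤ n² g h`, so `g h ≥ (h / 4)² ‖v‖²` for `0 < h ≤ 2`.
Integrated against `h^{-1-2s}` this gives a multiple of `‖v‖² / (s (1 - s))`, and
`C_s / (s (1 - s))` stays away from zero.

Compactness of `S` comes from approximation by functions constant on cells of length `δ`, with an
error of order `δ^s` (`exists_stepSpace_norm_sub_le`); density of its range comes from the smooth
functions with compact support (`eq_zero_of_forall_inner_H0s`), completeness of the energy
space from `completeSpace_energySpace`.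
-/

noncomputable section


/-! ### Diagonalization of compact operators -/

section Diagonalization

open scoped InnerProductSpace

universe u v

variable {G : Type v} {H : Type u} [NormedAddCommGroup G] [InnerProductSpace ℝ G] [CompleteSpace G]
  [NormedAddCommGroup H] [InnerProductSpace ℝ H] [CompleteSpace H]

/-- A compact self-adjoint operator has a Hilbert basis of eigenvectors. -/
theorem exists_hilbertBasis_eigenvectors {K : H →L[ℝ] H} (hK : IsCompactOperator K)
    (hsymm : (K : H →ₗ[ℝ] H).IsSymmetric) :
    ∃ (ι : Type u) (e : HilbertBasis ι ℝ H) (μ : ι → ℝ), ∀ i, K (e i) = μ i • e i := by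
  choose w b hb using fun μ : ℝ =>
    exists_hilbertBasis ℝ (Module.End.eigenspace (K : Module.End ℝ H) μ)
  have horth : OrthogonalFamily ℝ (fun μ : ℝ => Module.End.eigenspace (K : Module.End ℝ H) μ)
      fun μ => (Module.End.eigenspace (K : Module.End ℝ H) μ).subtypeₗᵢ :=
    hsymm.orthogonalFamily_eigenspaces
  have hon := horth.orthonormal_sigma_orthonormal (fun μ => (b μ).orthonormal)
  have hperp : (Submodule.span ℝ (range fun a : Σ μ : ℝ, w μ =>
      (Module.End.eigenspace (K : Module.End ℝ H) a.1).subtypeₗᵢ (b a.1 a.2)))ᗮ = ⊥ := by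
    rw [eq_bot_iff, ← ContinuousLinearMap.orthogonalComplement_iSup_eigenspaces_eq_bot hK hsymm]
    intro x hx
    rw [Submodule.mem_orthogonal] at hx
    rw [← Submodule.iInf_orthogonal, Submodule.mem_iInf]
    intro μ
    rw [Submodule.mem_orthogonal]
    intro u hu
    -- expand `u` in the basis of its eigenspace; each term is orthogonal to `x`
    have h1 := (b μ).hasSum_repr ⟨u, hu⟩
    have h2 := h1.mapL ((innerSL ℝ x).comp (Submodule.subtypeL _))
    have h3 : ∀ i, ((innerSL ℝ x).comp (Submodule.subtypeL _))
        ((b μ).repr ⟨u, hu⟩ i • (b μ) i) = 0 := by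
      intro i
      have h4 := hx _ (Submodule.subset_span ⟨⟨μ, i⟩, rfl⟩)
      rw [real_inner_comm] at h4
      rw [map_smul]
      exact (congrArg _ h4).trans (smul_zero _)
    simp only [h3] at h2
    have h5 := h2.unique hasSum_zero
    rw [real_inner_comm]
    exact h5
  refine ⟨Σ μ : ℝ, w μ, HilbertBasis.mkOfOrthogonalEqBot hon hperp, fun a => a.1, fun a => ?_⟩
  rw [HilbertBasis.coe_mkOfOrthogonalEqBot]
  exact Module.End.mem_eigenspace_iff.1 (b a.1 a.2).2

/-- The singular value decomposition of an injective compact operator with dense range: `eᵢ` are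
eigenvectors of `S S†`, and `gᵢ` is the normalized `S† eᵢ`. -/
theorem exists_singular_value_decomposition {S : G →L[ℝ] H} (hS : IsCompactOperator S)
    (hinj : Function.Injective S) (hadj : Function.Injective (ContinuousLinearMap.adjoint S)) :
    ∃ (ι : Type u) (e : HilbertBasis ι ℝ H) (g : HilbertBasis ι ℝ G) (σ : ι → ℝ),
      (∀ i, 0 < σ i) ∧ ∀ i, S (g i) = σ i • e i := by
  set A := ContinuousLinearMap.adjoint S with hA
  have hK : IsCompactOperator (S ∘L A) := hS.comp_clm A
  have hsymm : ((S ∘L A : H →L[ℝ] H) : H →ₗ[ℝ] H).IsSymmetric := by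
    intro x y
    simp [hA, ← ContinuousLinearMap.adjoint_inner_left]
  obtain ⟨ι, e, μ, hμ⟩ := exists_hilbertBasis_eigenvectors hK hsymm
  have hinner : ∀ i j, ⟪A (e i), A (e j)⟫_ℝ = μ j * ⟪e i, e j⟫_ℝ := by
    intro i j
    rw [hA, ContinuousLinearMap.adjoint_inner_left, ← inner_smul_right, ← hμ j]
    rfl
  have hnorm : ∀ i, ‖A (e i)‖ ^ 2 = μ i := by
    intro i
    rw [← real_inner_self_eq_norm_sq, hinner, real_inner_self_eq_norm_sq, e.orthonormal.1 i]
    ring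
  have hpos : ∀ i, 0 < μ i := by
    intro i
    rw [← hnorm i]
    have : A (e i) ≠ 0 := by
      intro h
      have h1 : e i = 0 := hadj (by rw [h, map_zero])
      simpa [h1] using e.orthonormal.1 i
    positivity
  have hon : Orthonormal ℝ fun i => (√(μ i))⁻¹ • A (e i) := by
    classical
    rw [orthonormal_iff_ite]
    intro i j
    rw [real_inner_smul_left, real_inner_smul_right, hinner, orthonormal_iff_ite.1 e.orthonormal]
    split_ifs with h
    · subst h
      have := Real.sqrt_pos.2 (hpos i)
      have h2 := Real.mul_self_sqrt (hpos i).le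
      field_simp
      nlinarith
    · simp
  have hperp : (Submodule.span ℝ (range fun i => (√(μ i))⁻¹ • A (e i)))ᗮ = ⊥ := by
    rw [eq_bot_iff]
    intro x hx
    rw [Submodule.mem_orthogonal] at hx
    have h0 : ∀ i, ⟪e i, S x⟫_ℝ = 0 := by
      intro i
      have h1 := hx _ (Submodule.subset_span ⟨i, rfl⟩)
      rw [real_inner_smul_left, hA, ContinuousLinearMap.adjoint_inner_left] at h1
      exact (mul_eq_zero.1 h1).resolve_left (inv_ne_zero (Real.sqrt_pos.2 (hpos i)).ne')
    have h1 : S x = 0 := by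
      have := e.hasSum_repr (S x)
      simp only [e.repr_apply_apply, h0, zero_smul] at this
      exact this.unique hasSum_zero
    exact (Submodule.mem_bot ℝ).2 (hinj (by rw [h1, map_zero]))
  refine ⟨ι, e, HilbertBasis.mkOfOrthogonalEqBot hon hperp, fun i => √(μ i),
    fun i => Real.sqrt_pos.2 (hpos i), fun i => ?_⟩
  rw [HilbertBasis.coe_mkOfOrthogonalEqBot, map_smul]
  have h1 : S (A (e i)) = μ i • e i := hμ i
  have := Real.sqrt_pos.2 (hpos i)
  rw [h1, smul_smul]
  congr 1
  field_simp
  exact (Real.sq_sqrt (hpos i).le).symm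

end Diagonalization

/-! ### The scalar modes -/

/-- Grönwall's inequality for absolutely continuous functions, with an integrable source. -/
theorem le_exp_mul_of_ae_deriv_le {n h : ℝ → ℝ} {κ t : ℝ} (ht : 0 ≤ t) (hκ : 0 ≤ κ)
    (hn : AbsolutelyContinuousOnInterval n 0 t) (hh : IntervalIntegrable h volume 0 t)
    (hh0 : ∀ x, 0 ≤ h x)
    (hd : ∀ᵐ x, x ∈ uIcc 0 t → deriv n x ≤ κ * n x + h x) :
    n t ≤ Real.exp (κ * t) * (n 0 + ∫ x in (0 : ℝ)..t, h x) := by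
  have hg : AbsolutelyContinuousOnInterval (fun x => Real.exp (-κ * x)) 0 t := by
    apply ContDiffOn.absolutelyContinuousOnInterval
    exact (by fun_prop : ContDiff ℝ 1 fun x => Real.exp (-κ * x)).contDiffOn
  have hg' : ∀ x, deriv (fun x => Real.exp (-κ * x)) x = Real.exp (-κ * x) * -κ := by
    intro x
    have := ((hasDerivAt_id x).const_mul (-κ)).exp
    simpa using this.deriv
  have key := hn.integral_deriv_mul_eq_sub hg
  have hle : ∫ x in (0 : ℝ)..t, (deriv n x * Real.exp (-κ * x) +
      n x * deriv (fun x => Real.exp (-κ * x)) x) ≤ ∫ x in (0 : ℝ)..t, h x := by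
    apply intervalIntegral.integral_mono_ae_restrict ht _ hh
    · rw [EventuallyLE, ae_restrict_iff' measurableSet_Icc]
      filter_upwards [hd] with x hx hxt
      have h1 := hx (by rwa [uIcc_of_le ht])
      have h2 : Real.exp (-κ * x) ≤ 1 := by
        apply Real.exp_le_one_iff.2
        nlinarith [hxt.1]
      have h3 := Real.exp_pos (-κ * x)
      have h4 := hh0 x
      rw [hg']
      nlinarith
    · apply IntervalIntegrable.add
      · exact hn.intervalIntegrable_deriv.mul_continuousOn hg.continuousOn
      · simp only [hg']
        exact (hn.continuousOn.mul (by fun_prop)).intervalIntegrable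
  rw [key] at hle
  simp only [mul_zero, Real.exp_zero, mul_one, neg_mul] at hle
  have h5 : n t * Real.exp (-(κ * t)) ≤ n 0 + ∫ x in (0 : ℝ)..t, h x := by linarith
  calc n t = Real.exp (κ * t) * (n t * Real.exp (-(κ * t))) := by
        rw [mul_left_comm, ← Real.exp_add]; simp
    _ ≤ _ := by gcongr

/-- The coefficients `a` (position, in the energy norm) and `w` (velocity) of a solution along a
singular vector with singular value `r⁻¹`: the integrated form of `a' = r w`,
`w' = - r a + M r ∫ a + f`, with initial values `a₀` and `b`. -/
structure IsMode (T M r : ℝ) (f : ℝ → ℝ) (a₀ b : ℝ) (a w : ℝ → ℝ) : Prop where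
  cont_pos : ContinuousOn a (Icc 0 T)
  cont_vel : ContinuousOn w (Icc 0 T)
  pos : ∀ t ∈ Icc 0 T, a t = a₀ + r * ∫ τ in (0 : ℝ)..t, w τ
  vel : ∀ t ∈ Icc 0 T, w t = b + ∫ τ in (0 : ℝ)..t,
    (-(r * a τ) + M * (r * ∫ ξ in (0 : ℝ)..τ, a ξ) + f τ)

/-- The exponential rate of the energy estimate. -/
def growthRate (M : ℝ) : ℝ := 2 * M ^ 2 + 2 * |M| + M ^ 4 + 3

/-- The constant of the energy estimate on `[0,T]`. -/
def growthConst (T M : ℝ) : ℝ := (2 + 2 * M ^ 2) * Real.exp (growthRate M * T)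

theorem growthRate_nonneg (M : ℝ) : 0 ≤ growthRate M := by
  unfold growthRate; positivity

theorem growthConst_pos (T M : ℝ) : 0 < growthConst T M := by
  unfold growthConst; positivity

/-- The energy estimate for one mode; the constant does not depend on `r`. -/
theorem IsMode.sq_add_sq_le {T M r : ℝ} {f a w : ℝ → ℝ} {a₀ b : ℝ}
    (h : IsMode T M r f a₀ b a w) (hf : IntervalIntegrable f volume 0 T)
    (hf2 : IntervalIntegrable (fun x => f x ^ 2) volume 0 T) {t : ℝ} (ht : t ∈ Icc 0 T) :
    a t ^ 2 + w t ^ 2 ≤ growthConst T M * (a₀ ^ 2 + b ^ 2 + ∫ x in (0 : ℝ)..T, f x ^ 2) := by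
  have hsub : Icc 0 t ⊆ Icc 0 T := Icc_subset_Icc_right ht.2
  have hu : uIcc 0 t = Icc 0 t := uIcc_of_le ht.1
  have h0u : (0 : ℝ) ∈ uIcc 0 t := left_mem_uIcc
  have hai : IntervalIntegrable a volume 0 t :=
    (h.cont_pos.mono (by rwa [hu])).intervalIntegrable
  have hwi : IntervalIntegrable w volume 0 t :=
    (h.cont_vel.mono (by rwa [hu])).intervalIntegrable
  have hfi : IntervalIntegrable f volume 0 t :=
    hf.mono_set (by rw [hu, uIcc_of_le (ht.1.trans ht.2)]; exact hsub)
  have hfi2 : IntervalIntegrable (fun x => f x ^ 2) volume 0 t :=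
    hf2.mono_set (by rw [hu, uIcc_of_le (ht.1.trans ht.2)]; exact hsub)
  set z : ℝ → ℝ := fun τ => ∫ ξ in (0 : ℝ)..τ, a ξ with hz
  set q : ℝ → ℝ := fun τ => -(r * a τ) + M * (r * z τ) + f τ with hq
  have hzac : AbsolutelyContinuousOnInterval z 0 t :=
    hai.absolutelyContinuousOnInterval_intervalIntegral h0u
  have hqi : IntervalIntegrable q volume 0 t := by
    refine ((hai.const_mul r).neg.add ?_).add hfi
    exact (hzac.continuousOn.intervalIntegrable.const_mul r).const_mul M
  -- `A` and `W` agree with `a` and `w` on `[0,T]`, but are primitives on all of `ℝ`, so that the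
  -- two-sided derivatives below make sense
  set A : ℝ → ℝ := fun τ => a₀ + r * ∫ ξ in (0 : ℝ)..τ, w ξ with hA
  set W : ℝ → ℝ := fun τ => b + ∫ ξ in (0 : ℝ)..τ, q ξ with hW
  have hconst : ∀ c : ℝ, AbsolutelyContinuousOnInterval (fun _ => c) 0 t := fun c =>
    (contDiff_const (n := 1)).contDiffOn.absolutelyContinuousOnInterval
  have hAac : AbsolutelyContinuousOnInterval A 0 t :=
    (hconst a₀).fun_add ((hwi.absolutelyContinuousOnInterval_intervalIntegral h0u).const_mul r)
  have hWac : AbsolutelyContinuousOnInterval W 0 t :=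
    (hconst b).fun_add (hqi.absolutelyContinuousOnInterval_intervalIntegral h0u)
  have hpac : AbsolutelyContinuousOnInterval (fun τ => A τ - M * z τ) 0 t :=
    hAac.fun_sub (hzac.const_mul M)
  set n : ℝ → ℝ := fun τ => z τ * z τ + (A τ - M * z τ) * (A τ - M * z τ) + W τ * W τ with hn
  have hnac : AbsolutelyContinuousOnInterval n 0 t :=
    ((hzac.fun_mul hzac).fun_add (hpac.fun_mul hpac)).fun_add (hWac.fun_mul hWac)
  have hd : ∀ᵐ x, x ∈ uIcc 0 t → deriv n x ≤ growthRate M * n x + f x ^ 2 := by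
    filter_upwards [hai.ae_hasDerivAt_integral, hwi.ae_hasDerivAt_integral,
      hqi.ae_hasDerivAt_integral] with x h1 h2 h3 hx
    have hxT : x ∈ Icc 0 T := hsub (by rwa [← hu])
    have d1 : HasDerivAt z (a x) x := h1 hx 0 h0u
    have d2 : HasDerivAt A (r * w x) x := ((h2 hx 0 h0u).const_mul r).const_add a₀
    have d3 : HasDerivAt W (q x) x := (h3 hx 0 h0u).const_add b
    have d4 := d2.fun_sub (d1.const_mul M)
    have d5 : HasDerivAt n _ x := ((d1.fun_mul d1).fun_add (d4.fun_mul d4)).fun_add (d3.fun_mul d3)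
    rw [d5.deriv]
    have eA : A x = a x := (h.pos x hxT).symm
    have eW : W x = w x := (h.vel x hxT).symm
    simp only [hn, eA, eW, hq]
    -- in terms of `p = a - M z` the terms with `r` cancel
    obtain ⟨p, hp⟩ : ∃ p, p = a x - M * z x := ⟨_, rfl⟩
    have ha : a x = p + M * z x := by linarith
    rw [ha]
    have hM : M * z x ^ 2 ≤ |M| * z x ^ 2 := by gcongr; exact le_abs_self M
    have hM' : -M * p ^ 2 ≤ |M| * p ^ 2 := by gcongr; exact neg_le_abs M
    unfold growthRate
    have e1 := sq_nonneg (z x - p)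
    have e2 := sq_nonneg (M ^ 2 * z x + p)
    have e3 := sq_nonneg (w x - f x)
    have e4 := sq_nonneg (M * z x)
    have e5 := sq_nonneg (M * p)
    have e6 := sq_nonneg (M * w x)
    have e7 := sq_nonneg (M ^ 2 * p)
    have e8 := sq_nonneg (M ^ 2 * w x)
    have e9 : 0 ≤ |M| * w x ^ 2 := by positivity
    nlinarith [sq_nonneg (w x), sq_nonneg (z x), sq_nonneg p, sq_nonneg (f x)]
  have key := le_exp_mul_of_ae_deriv_le ht.1 (growthRate_nonneg M) hnac hfi2
    (fun x => sq_nonneg _) hd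
  have hn0 : n 0 = a₀ ^ 2 + b ^ 2 := by simp [hn, hA, hW, hz]; ring
  have hnt : a t ^ 2 + w t ^ 2 ≤ (2 + 2 * M ^ 2) * n t := by
    have eA : A t = a t := (h.pos t ht).symm
    have eW : W t = w t := (h.vel t ht).symm
    simp only [hn, eA, eW]
    nlinarith [sq_nonneg (a t - 2 * M * z t), sq_nonneg (z t), sq_nonneg (w t),
      sq_nonneg (M * w t), sq_nonneg (M * (a t - M * z t)), sq_nonneg (M * z t)]
  have hmono : ∫ x in (0 : ℝ)..t, f x ^ 2 ≤ ∫ x in (0 : ℝ)..T, f x ^ 2 :=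
    intervalIntegral.integral_mono_interval le_rfl ht.1 ht.2
      (Eventually.of_forall fun x => sq_nonneg _) hf2
  have hint : 0 ≤ ∫ x in (0 : ℝ)..t, f x ^ 2 :=
    intervalIntegral.integral_nonneg ht.1 fun x _ => sq_nonneg _
  rw [hn0] at key
  calc a t ^ 2 + w t ^ 2 ≤ (2 + 2 * M ^ 2) * n t := hnt
    _ ≤ (2 + 2 * M ^ 2) * (Real.exp (growthRate M * T) *
          (a₀ ^ 2 + b ^ 2 + ∫ x in (0 : ℝ)..T, f x ^ 2)) := by
        gcongr
        refine key.trans ?_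
        have := growthRate_nonneg M
        have := ht.2
        gcongr
    _ = _ := by unfold growthConst; ring

/-- Linear Volterra equations with a bounded operator are solvable, by Duhamel's formula. -/
theorem exists_linear_volterra {E : Type*} [NormedAddCommGroup E] [NormedSpace ℝ E]
    [CompleteSpace E] (B : E →L[ℝ] E) {Φ : ℝ → E} (hΦ : Continuous Φ) :
    ∃ X : ℝ → E, Continuous X ∧ ∀ t, X t = Φ t + ∫ τ in (0 : ℝ)..t, B (X τ) := by
  have hexp : ∀ t : ℝ, HasDerivAt (fun t : ℝ => NormedSpace.exp (t • B))
      (B * NormedSpace.exp (t • B)) t := fun t => hasDerivAt_exp_smul_const' B t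
  have hcont : Continuous fun t : ℝ => NormedSpace.exp (t • B) :=
    continuous_iff_continuousAt.2 fun t => (hexp t).continuousAt
  have hc2 : Continuous fun τ : ℝ => NormedSpace.exp ((-τ) • B) (B (Φ τ)) :=
    (hcont.comp continuous_neg).clm_apply (B.continuous.comp hΦ)
  -- `V = X - Φ` solves `V' = B V + B Φ` with a continuous source
  set V : ℝ → E := fun t => NormedSpace.exp (t • B)
    (∫ τ in (0 : ℝ)..t, NormedSpace.exp ((-τ) • B) (B (Φ τ))) with hV
  have hVd : ∀ t, HasDerivAt V (B (V t + Φ t)) t := by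
    intro t
    have h1 := (hexp t).clm_apply (intervalIntegral.integral_hasDerivAt_right
      (hc2.intervalIntegrable 0 t) (hc2.stronglyMeasurableAtFilter _ _) hc2.continuousAt)
    convert! h1 using 1
    have h2 : NormedSpace.exp (t • B) * NormedSpace.exp ((-t) • B) = 1 := by
      let : NormedAlgebra ℚ (E →L[ℝ] E) := NormedAlgebra.restrictScalars ℚ ℝ _
      rw [← NormedSpace.exp_add_of_commute]
      · simp
      · exact (Commute.refl B).smul_left _ |>.smul_right _
    rw [map_add]
    congr 1
    change _ = (NormedSpace.exp (t • B) * NormedSpace.exp ((-t) • B)) (B (Φ t))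
    rw [h2]; rfl
  have hVc : Continuous V := continuous_iff_continuousAt.2 fun t => (hVd t).continuousAt
  refine ⟨fun t => V t + Φ t, hVc.add hΦ, fun t => ?_⟩
  rw [intervalIntegral.integral_eq_sub_of_hasDerivAt (fun x _ => hVd x)
    ((B.continuous.comp (hVc.add hΦ)).intervalIntegrable 0 t)]
  simp [hV, add_comm]

/-- The unknowns of the Volterra equation are `(∫ a, a, w)`. -/
theorem exists_isMode {T : ℝ} (hT : 0 ≤ T) (M r : ℝ) {f : ℝ → ℝ}
    (hf : IntervalIntegrable f volume 0 T) (a₀ b : ℝ) :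
    ∃ a w : ℝ → ℝ, IsMode T M r f a₀ b a w := by
  set F : ℝ → ℝ := (Ioc 0 T).indicator f with hF
  have hFi : Integrable F := by
    rw [hF, integrable_indicator_iff measurableSet_Ioc]
    exact (intervalIntegrable_iff_integrableOn_Ioc_of_le hT).1 hf
  have hFc : Continuous fun t => ∫ τ in (0 : ℝ)..t, F τ :=
    intervalIntegral.continuous_primitive (fun _ _ => hFi.intervalIntegrable) 0
  let pz : ℝ × ℝ × ℝ →L[ℝ] ℝ := ContinuousLinearMap.fst ℝ ℝ (ℝ × ℝ)
  let pa : ℝ × ℝ × ℝ →L[ℝ] ℝ :=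
    (ContinuousLinearMap.fst ℝ ℝ ℝ).comp (ContinuousLinearMap.snd ℝ ℝ (ℝ × ℝ))
  let pw : ℝ × ℝ × ℝ →L[ℝ] ℝ :=
    (ContinuousLinearMap.snd ℝ ℝ ℝ).comp (ContinuousLinearMap.snd ℝ ℝ (ℝ × ℝ))
  let B : ℝ × ℝ × ℝ →L[ℝ] ℝ × ℝ × ℝ :=
    pa.prod ((r • pw).prod ((-r) • pa + (M * r) • pz))
  obtain ⟨X, hXc, hX⟩ := exists_linear_volterra B
    (Φ := fun t => (0, a₀, b + ∫ τ in (0 : ℝ)..t, F τ)) (by fun_prop)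
  have hi : ∀ t, IntervalIntegrable (fun τ => B (X τ)) volume 0 t := fun t =>
    (B.continuous.comp hXc).intervalIntegrable 0 t
  have hz : ∀ t, (X t).1 = ∫ τ in (0 : ℝ)..t, (X τ).2.1 := by
    intro t
    have h1 := congrArg pz (hX t)
    rw [map_add, ← ContinuousLinearMap.intervalIntegral_comp_comm _ (hi t)] at h1
    simpa [pz, B, pa] using h1
  have ha : ∀ t, (X t).2.1 = a₀ + r * ∫ τ in (0 : ℝ)..t, (X τ).2.2 := by
    intro t
    have h1 := congrArg pa (hX t)
    rw [map_add, ← ContinuousLinearMap.intervalIntegral_comp_comm _ (hi t)] at h1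
    simpa [pz, B, pa, pw] using h1
  have hw : ∀ t, (X t).2.2 = b + (∫ τ in (0 : ℝ)..t, F τ) +
      ∫ τ in (0 : ℝ)..t, (-(r * (X τ).2.1) + M * r * (X τ).1) := by
    intro t
    have h1 := congrArg pw (hX t)
    rw [map_add, ← ContinuousLinearMap.intervalIntegral_comp_comm _ (hi t)] at h1
    simpa [pz, B, pa, pw] using h1
  refine ⟨fun t => (X t).2.1, fun t => (X t).2.2, by fun_prop, by fun_prop, fun t _ => ha t,
    fun t ht => ?_⟩
  rw [hw t, add_assoc, ← intervalIntegral.integral_add hFi.intervalIntegrable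
    (Continuous.intervalIntegrable (by fun_prop) _ _)]
  congr 1
  apply intervalIntegral.integral_congr_ae
  refine Eventually.of_forall fun τ hτ => ?_
  rw [uIoc_of_le ht.1] at hτ
  have : F τ = f τ := indicator_of_mem (show τ ∈ Ioc 0 T from ⟨hτ.1, hτ.2.trans ht.2⟩) f
  rw [this, hz τ]
  ring

/-! ### The abstract wave equation with memory -/

section AbstractWave

open scoped InnerProductSpace

theorem HilbertBasis.ext_inner {ι E : Type*} [NormedAddCommGroup E] [InnerProductSpace ℝ E]
    (b : HilbertBasis ι ℝ E) {x y : E} (h : ∀ i, ⟪x, b i⟫_ℝ = ⟪y, b i⟫_ℝ) : x = y := by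
  refine b.repr.injective (lp.ext (funext fun i => ?_))
  rw [b.repr_apply_apply, b.repr_apply_apply, real_inner_comm, h, real_inner_comm]

theorem HilbertBasis.hasSum_inner_sq {ι E : Type*} [NormedAddCommGroup E] [InnerProductSpace ℝ E]
    (b : HilbertBasis ι ℝ E) (x : E) : HasSum (fun i => ⟪x, b i⟫_ℝ ^ 2) (‖x‖ ^ 2) := by
  have h := b.hasSum_inner_mul_inner x x
  rw [real_inner_self_eq_norm_sq] at h
  refine h.congr_fun ?_ |> id
  intro i
  rw [real_inner_comm x (b i), sq]

/-- A family of continuous coefficients with summable uniform bounds on the squares is the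
coefficient family of a continuous curve. -/
theorem HilbertBasis.exists_continuousOn_inner_eq {ι E : Type*} [NormedAddCommGroup E]
    [InnerProductSpace ℝ E] (b : HilbertBasis ι ℝ E) {s : Set ℝ} {a : ι → ℝ → ℝ} {B : ι → ℝ}
    (hB : Summable B) (hc : ∀ i, ContinuousOn (a i) s) (ha : ∀ i, ∀ t ∈ s, a i t ^ 2 ≤ B i) :
    ∃ Y : ℝ → E, ContinuousOn Y s ∧ ∀ t ∈ s, ∀ i, ⟪Y t, b i⟫_ℝ = a i t := by
  have hex : ∀ t : ℝ, ∃ y : E, t ∈ s → ∀ i, ⟪y, b i⟫_ℝ = a i t := by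
    intro t
    by_cases ht : t ∈ s
    · have hmem : Memℓp (fun i => a i t) 2 := by
        apply memℓp_gen
        refine Summable.of_nonneg_of_le (fun i => by positivity) (fun i => ?_) hB
        simpa using ha i t ht
      refine ⟨b.repr.symm ⟨_, hmem⟩, fun _ i => ?_⟩
      rw [real_inner_comm, ← b.repr_apply_apply, LinearIsometryEquiv.apply_symm_apply]
    · exact ⟨0, fun h => absurd h ht⟩
  choose Y hY using hex
  refine ⟨Y, fun t₀ ht₀ => ?_, fun t ht => hY t ht⟩
  have hlim : Tendsto (fun t => ∑' i, (a i t - a i t₀) ^ 2) (𝓝[s] t₀) (𝓝 (∑' _ : ι, (0 : ℝ))) := by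
    refine tendsto_tsum_of_dominated_convergence (hB.mul_left 4) (fun i => ?_) ?_
    · have : Tendsto (fun t => (a i t - a i t₀) ^ 2) (𝓝[s] t₀) (𝓝 ((a i t₀ - a i t₀) ^ 2)) :=
        ((hc i t₀ ht₀).sub_const _).pow 2
      simpa using this
    · filter_upwards [self_mem_nhdsWithin] with t ht i
      rw [Real.norm_eq_abs, abs_of_nonneg (sq_nonneg _)]
      nlinarith [ha i t ht, ha i t₀ ht₀, sq_nonneg (a i t + a i t₀)]
  rw [tsum_zero] at hlim
  rw [ContinuousWithinAt, tendsto_iff_norm_sub_tendsto_zero]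
  have hsq : Tendsto (fun t => ‖Y t - Y t₀‖ ^ 2) (𝓝[s] t₀) (𝓝 0) := by
    refine hlim.congr' ?_
    filter_upwards [self_mem_nhdsWithin] with t ht
    rw [← (b.hasSum_inner_sq (Y t - Y t₀)).tsum_eq]
    refine tsum_congr fun i => ?_
    rw [inner_sub_left, hY t ht, hY t₀ ht₀]
  simpa using hsq.sqrt

variable {G H : Type*} [NormedAddCommGroup G] [InnerProductSpace ℝ G]
  [NormedAddCommGroup H] [InnerProductSpace ℝ H]

theorem intervalIntegrable_inner_sq {T : ℝ} {f : ℝ → H}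
    (hfm : ∀ h : H, IntervalIntegrable (fun τ => ⟪f τ, h⟫_ℝ) volume 0 T)
    (hfsq : IntervalIntegrable (fun τ => ‖f τ‖ ^ 2) volume 0 T) (h : H) :
    IntervalIntegrable (fun τ => ⟪f τ, h⟫_ℝ ^ 2) volume 0 T := by
  refine (hfsq.mul_const (‖h‖ ^ 2)).mono_fun ((hfm h).def'.aestronglyMeasurable.pow 2)
    (Eventually.of_forall fun τ => ?_)
  beta_reduce
  rw [Real.norm_of_nonneg (sq_nonneg _), Real.norm_of_nonneg (by positivity), ← mul_pow,
    ← sq_abs]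
  gcongr
  exact abs_real_inner_le_norm _ _

/-- Bessel's inequality for the data. -/
theorem sum_inner_sq_add_le {ι : Type*} {T : ℝ} (hT : 0 ≤ T) {e : HilbertBasis ι ℝ H}
    {g : HilbertBasis ι ℝ G} {f : ℝ → H}
    (hfm : ∀ h : H, IntervalIntegrable (fun τ => ⟪f τ, h⟫_ℝ) volume 0 T)
    (hfsq : IntervalIntegrable (fun τ => ‖f τ‖ ^ 2) volume 0 T) (y₀ : G) (y₁ : H) (s : Finset ι) :
    ∑ i ∈ s, (⟪y₀, g i⟫_ℝ ^ 2 + ⟪y₁, e i⟫_ℝ ^ 2 + ∫ τ in (0 : ℝ)..T, ⟪f τ, e i⟫_ℝ ^ 2) ≤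
      ‖y₀‖ ^ 2 + ‖y₁‖ ^ 2 + ∫ τ in (0 : ℝ)..T, ‖f τ‖ ^ 2 := by
  rw [Finset.sum_add_distrib, Finset.sum_add_distrib]
  have hb : ∀ x : H, ∑ i ∈ s, ⟪x, e i⟫_ℝ ^ 2 ≤ ‖x‖ ^ 2 := fun x =>
    sum_le_hasSum s (fun _ _ => sq_nonneg _) (e.hasSum_inner_sq x)
  gcongr
  · exact sum_le_hasSum s (fun _ _ => sq_nonneg _) (g.hasSum_inner_sq y₀)
  · exact hb y₁
  · rw [← intervalIntegral.integral_finsetSum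
      fun i _ => intervalIntegrable_inner_sq hfm hfsq (e i)]
    refine intervalIntegral.integral_mono_on hT ?_ hfsq fun τ _ => hb _
    simpa only [Finset.sum_fn] using
      IntervalIntegrable.sum s fun i _ => intervalIntegrable_inner_sq hfm hfsq (e i)

/-- `Y` and `W` are the position in the energy space `G` and the velocity in `H` of a solution of
the wave equation with memory whose stiffness form is the inner product of `G`, seen in `H` through
the embedding `S`; the equation is tested with the elements of `G` and integrated once in time. -/
structure IsWeakSolution (S : G →L[ℝ] H) (T M : ℝ) (f : ℝ → H) (y₀ : G) (y₁ : H)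
    (Y : ℝ → G) (W : ℝ → H) : Prop where
  cont_pos : ContinuousOn Y (Icc 0 T)
  cont_vel : ContinuousOn W (Icc 0 T)
  pos : ∀ t ∈ Icc 0 T, S (Y t) = S y₀ + ∫ τ in (0 : ℝ)..t, W τ
  vel : ∀ v : G, ∀ t ∈ Icc 0 T, ⟪W t, S v⟫_ℝ = ⟪y₁, S v⟫_ℝ + ∫ τ in (0 : ℝ)..t,
    (-⟪Y τ, v⟫_ℝ + M * (∫ ξ in (0 : ℝ)..τ, ⟪Y ξ, v⟫_ℝ) + ⟪f τ, S v⟫_ℝ)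

theorem inner_intervalIntegral_left {E : Type*} [NormedAddCommGroup E] [InnerProductSpace ℝ E]
    [CompleteSpace E] {Y : ℝ → E} {a b : ℝ} (hY : IntervalIntegrable Y volume a b) (v : E) :
    ⟪∫ τ in a..b, Y τ, v⟫_ℝ = ∫ τ in a..b, ⟪Y τ, v⟫_ℝ := by
  have := (innerSL ℝ v).intervalIntegral_comp_comm hY
  simp only [innerSL_apply_apply] at this
  rw [real_inner_comm, ← this]
  simp only [real_inner_comm]

variable [CompleteSpace G] [CompleteSpace H]

/-- In coordinates `S` is multiplication by the singular values. -/
theorem inner_apply_singular {ι : Type*} {S : G →L[ℝ] H} {e : HilbertBasis ι ℝ H}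
    {g : HilbertBasis ι ℝ G} {σ : ι → ℝ} (hS : ∀ i, S (g i) = σ i • e i) (x : G) (i : ι) :
    ⟪S x, e i⟫_ℝ = σ i * ⟪x, g i⟫_ℝ := by
  rw [← ContinuousLinearMap.adjoint_inner_right, ← inner_smul_right]
  congr 1
  refine g.ext_inner fun j => ?_
  classical
  rw [ContinuousLinearMap.adjoint_inner_left, hS, inner_smul_right, real_inner_smul_left,
    orthonormal_iff_ite.1 e.orthonormal, orthonormal_iff_ite.1 g.orthonormal]
  split_ifs with h
  · rw [h]
  · simp

theorem IsMode.sub {T M r : ℝ} {f a w a' w' : ℝ → ℝ} {a₀ b : ℝ}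
    (hf : IntervalIntegrable f volume 0 T)
    (h : IsMode T M r f a₀ b a w) (h' : IsMode T M r f a₀ b a' w') :
    IsMode T M r (fun _ => 0) 0 0 (fun t => a t - a' t) (fun t => w t - w' t) := by
  have int : ∀ {k : ℝ → ℝ}, ContinuousOn k (Icc 0 T) → ∀ t ∈ Icc 0 T,
      IntervalIntegrable k volume 0 t := fun {k} hk t ht =>
    (hk.mono (by rw [uIcc_of_le ht.1]; exact Icc_subset_Icc_right ht.2)).intervalIntegrable
      (μ := volume)
  refine ⟨h.cont_pos.sub h'.cont_pos, h.cont_vel.sub h'.cont_vel, fun t ht => ?_, fun t ht => ?_⟩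
  · rw [intervalIntegral.integral_sub (int h.cont_vel t ht) (int h'.cont_vel t ht),
      h.pos t ht, h'.pos t ht]
    ring
  · have aux : ∀ {k : ℝ → ℝ}, ContinuousOn k (Icc 0 T) → IntervalIntegrable
        (fun τ => -(r * k τ) + M * (r * ∫ ξ in (0 : ℝ)..τ, k ξ) + f τ) volume 0 t := by
      intro k hk
      have hz := ((int hk t ht).absolutelyContinuousOnInterval_intervalIntegral
        left_mem_uIcc).continuousOn.intervalIntegrable (μ := volume)
      refine (((int hk t ht).const_mul r).neg.add ((hz.const_mul r).const_mul M)).add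
        (hf.mono_set ?_)
      rw [uIcc_of_le ht.1, uIcc_of_le (ht.1.trans ht.2)]
      exact Icc_subset_Icc_right ht.2
    rw [h.vel t ht, h'.vel t ht, add_sub_add_left_eq_sub, zero_add,
      ← intervalIntegral.integral_sub (aux h.cont_pos) (aux h'.cont_pos)]
    refine intervalIntegral.integral_congr fun τ hτ => ?_
    rw [uIcc_of_le ht.1] at hτ
    have hτT : τ ∈ Icc 0 T := ⟨hτ.1, hτ.2.trans ht.2⟩
    rw [intervalIntegral.integral_sub (int h.cont_pos τ hτT) (int h'.cont_pos τ hτT)]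
    ring

theorem IsMode.eq {T M r : ℝ} {f a w a' w' : ℝ → ℝ} {a₀ b : ℝ}
    (hf : IntervalIntegrable f volume 0 T)
    (h : IsMode T M r f a₀ b a w) (h' : IsMode T M r f a₀ b a' w') {t : ℝ} (ht : t ∈ Icc 0 T) :
    a t = a' t := by
  have := (IsMode.sub hf h h').sq_add_sq_le (by simp) (by simp) ht
  simp only [ne_eq, OfNat.ofNat_ne_zero, not_false_eq_true, zero_pow, add_zero,
    intervalIntegral.integral_zero, mul_zero] at this
  nlinarith [sq_nonneg (w t - w' t)]

theorem IsWeakSolution.isMode {ι : Type*} {S : G →L[ℝ] H} {e : HilbertBasis ι ℝ H}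
    {g : HilbertBasis ι ℝ G} {σ : ι → ℝ} (hσ : ∀ i, 0 < σ i) (hS : ∀ i, S (g i) = σ i • e i)
    {T M : ℝ} {f : ℝ → H} {y₀ : G} {y₁ : H} {Y : ℝ → G} {W : ℝ → H}
    (h : IsWeakSolution S T M f y₀ y₁ Y W) (i : ι) :
    IsMode T M (σ i)⁻¹ (fun τ => ⟪f τ, e i⟫_ℝ) ⟪y₀, g i⟫_ℝ ⟪y₁, e i⟫_ℝ
      (fun t => ⟪Y t, g i⟫_ℝ) (fun t => ⟪W t, e i⟫_ℝ) := by
  refine ⟨h.cont_pos.inner continuousOn_const, h.cont_vel.inner continuousOn_const,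
    fun t ht => ?_, fun t ht => ?_⟩
  · have hW : IntervalIntegrable W volume 0 t :=
      (h.cont_vel.mono (by
        rw [uIcc_of_le ht.1]; exact Icc_subset_Icc_right ht.2)).intervalIntegrable
    have h1 := congrArg (fun x => ⟪x, e i⟫_ℝ) (h.pos t ht)
    simp only [inner_add_left, inner_apply_singular hS, inner_intervalIntegral_left hW] at h1
    have := hσ i
    field_simp
    linarith
  · have h1 := h.vel (g i) t ht
    simp only [hS, inner_smul_right] at h1
    have h2 : (σ i)⁻¹ * σ i = 1 := inv_mul_cancel₀ (hσ i).ne'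
    have h3 : ⟪W t, e i⟫_ℝ = (σ i)⁻¹ * (σ i * ⟪W t, e i⟫_ℝ) := by rw [← mul_assoc, h2, one_mul]
    rw [h3, h1, mul_add, ← mul_assoc, h2, one_mul, ← intervalIntegral.integral_const_mul]
    congr 2
    funext τ
    linear_combination ⟪f τ, e i⟫_ℝ * h2

/-- The forcing is only required to be weakly measurable with square integrable norm. -/
theorem exists_isWeakSolution {ι : Type*} {S : G →L[ℝ] H} {e : HilbertBasis ι ℝ H}
    {g : HilbertBasis ι ℝ G} {σ : ι → ℝ} (hσ : ∀ i, 0 < σ i) (hS : ∀ i, S (g i) = σ i • e i)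
    {T : ℝ} (hT : 0 ≤ T) (M : ℝ) {f : ℝ → H}
    (hfm : ∀ h : H, IntervalIntegrable (fun τ => ⟪f τ, h⟫_ℝ) volume 0 T)
    (hfsq : IntervalIntegrable (fun τ => ‖f τ‖ ^ 2) volume 0 T) (y₀ : G) (y₁ : H) :
    ∃ Y W, IsWeakSolution S T M f y₀ y₁ Y W := by
  choose a w h using fun i => exists_isMode hT M (σ i)⁻¹ (hfm (e i)) ⟪y₀, g i⟫_ℝ ⟪y₁, e i⟫_ℝ
  have hbound := fun i t (ht : t ∈ Icc 0 T) =>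
    (h i).sq_add_sq_le (hfm (e i)) (intervalIntegrable_inner_sq hfm hfsq (e i)) ht
  have hsum : Summable fun i => growthConst T M *
      (⟪y₀, g i⟫_ℝ ^ 2 + ⟪y₁, e i⟫_ℝ ^ 2 + ∫ τ in (0 : ℝ)..T, ⟪f τ, e i⟫_ℝ ^ 2) := by
    apply Summable.mul_left
    refine summable_of_sum_le (fun i => ?_) (sum_inner_sq_add_le hT hfm hfsq y₀ y₁)
    have : 0 ≤ ∫ τ in (0 : ℝ)..T, ⟪f τ, e i⟫_ℝ ^ 2 :=
      intervalIntegral.integral_nonneg hT fun _ _ => sq_nonneg _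
    positivity
  obtain ⟨Y, hYc, hY⟩ := g.exists_continuousOn_inner_eq hsum (fun i => (h i).cont_pos)
    (fun i t ht => by nlinarith [hbound i t ht, sq_nonneg (w i t)])
  obtain ⟨W, hWc, hW⟩ := e.exists_continuousOn_inner_eq hsum (fun i => (h i).cont_vel)
    (fun i t ht => by nlinarith [hbound i t ht, sq_nonneg (a i t)])
  have hsub : ∀ t ∈ Icc 0 T, uIcc 0 t ⊆ Icc 0 T := fun t ht => by
    rw [uIcc_of_le ht.1]; exact Icc_subset_Icc_right ht.2
  have hYi : ∀ t ∈ Icc 0 T, IntervalIntegrable Y volume 0 t := fun t ht =>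
    (hYc.mono (hsub t ht)).intervalIntegrable
  have hWi : ∀ t ∈ Icc 0 T, IntervalIntegrable W volume 0 t := fun t ht =>
    (hWc.mono (hsub t ht)).intervalIntegrable
  refine ⟨Y, W, hYc, hWc, fun t ht => ?_, fun v t ht => ?_⟩
  · refine e.ext_inner fun i => ?_
    rw [inner_add_left, inner_apply_singular hS, inner_apply_singular hS, hY t ht,
      inner_intervalIntegral_left (hWi t ht), (h i).pos t ht]
    have h1 : ∫ τ in (0 : ℝ)..t, ⟪W τ, e i⟫_ℝ = ∫ τ in (0 : ℝ)..t, w i τ :=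
      intervalIntegral.integral_congr fun τ hτ => hW τ (hsub t ht hτ) i
    rw [h1]
    have := (hσ i).ne'
    field_simp
  · have hfn : IntervalIntegrable (fun τ => ‖f τ‖) volume 0 t := by
      have h1 : IntervalIntegrable (fun τ => 1 + ‖f τ‖ ^ 2) volume 0 T :=
        intervalIntegrable_const.add hfsq
      have h2 : IntervalIntegrable (fun τ => ‖f τ‖) volume 0 T := by
        refine h1.mono_fun ?_ (Eventually.of_forall fun τ => ?_)
        · have := (Real.continuous_sqrt.comp_aestronglyMeasurable hfsq.def'.aestronglyMeasurable)
          simpa [Function.comp_def, Real.sqrt_sq (norm_nonneg _)] using this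
        · beta_reduce
          rw [norm_norm, Real.norm_of_nonneg (by positivity)]
          nlinarith [sq_nonneg (‖f τ‖ - 1)]
      exact h2.mono_set (by rw [uIcc_of_le hT]; exact hsub t ht)
    have hfi : ∀ x : H, IntervalIntegrable (fun τ => ⟪f τ, x⟫_ℝ) volume 0 t := fun x =>
      (hfm x).mono_set (by rw [uIcc_of_le hT]; exact hsub t ht)
    let Λ : H →L[ℝ] ℝ := LinearMap.mkContinuous
      { toFun := fun x => ∫ τ in (0 : ℝ)..t, ⟪f τ, x⟫_ℝ
        map_add' := fun x y => by
          simp only [inner_add_right]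
          exact intervalIntegral.integral_add (hfi x) (hfi y)
        map_smul' := fun c x => by
          simp only [inner_smul_right, RingHom.id_apply, smul_eq_mul]
          exact intervalIntegral.integral_const_mul _ _ }
      (∫ τ in (0 : ℝ)..t, ‖f τ‖) (fun x => by
        rw [← intervalIntegral.integral_mul_const]
        exact intervalIntegral.norm_integral_le_of_norm_le ht.1
          (Eventually.of_forall fun τ _ => abs_real_inner_le_norm _ _) (hfn.mul_const _))
    have hZc : ContinuousOn (fun τ => ∫ ξ in (0 : ℝ)..τ, Y ξ) (uIcc 0 t) :=
      intervalIntegral.continuousOn_primitive_interval' (hYi t ht) left_mem_uIcc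
    let Z : G := -(∫ τ in (0 : ℝ)..t, Y τ) + M • ∫ τ in (0 : ℝ)..t, ∫ ξ in (0 : ℝ)..τ, Y ξ
    -- the right-hand side of the equation is a continuous functional of the test function
    have hrhs : ∀ v : G, ∫ τ in (0 : ℝ)..t, (-⟪Y τ, v⟫_ℝ + M * (∫ ξ in (0 : ℝ)..τ, ⟪Y ξ, v⟫_ℝ) +
        ⟪f τ, S v⟫_ℝ) = (innerSL ℝ Z + Λ.comp S) v := by
      intro v
      have h1 : ∫ τ in (0 : ℝ)..t, (-⟪Y τ, v⟫_ℝ + M * (∫ ξ in (0 : ℝ)..τ, ⟪Y ξ, v⟫_ℝ) +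
          ⟪f τ, S v⟫_ℝ) = ∫ τ in (0 : ℝ)..t, (-⟪Y τ, v⟫_ℝ +
            M * ⟪∫ ξ in (0 : ℝ)..τ, Y ξ, v⟫_ℝ + ⟪f τ, S v⟫_ℝ) := by
        refine intervalIntegral.integral_congr fun τ hτ => ?_
        rw [inner_intervalIntegral_left (hYi τ (hsub t ht hτ))]
      have i1 : IntervalIntegrable (fun τ => -⟪Y τ, v⟫_ℝ) volume 0 t :=
        ((hYc.mono (hsub t ht)).inner continuousOn_const).neg.intervalIntegrable
      have i2 : IntervalIntegrable (fun τ => M * ⟪∫ ξ in (0 : ℝ)..τ, Y ξ, v⟫_ℝ) volume 0 t :=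
        (continuousOn_const.mul (hZc.inner continuousOn_const)).intervalIntegrable
      rw [h1, intervalIntegral.integral_add (i1.add i2) (hfi _),
        intervalIntegral.integral_add i1 i2,
        intervalIntegral.integral_neg, intervalIntegral.integral_const_mul,
        ← inner_intervalIntegral_left (hYi t ht), ← inner_intervalIntegral_left
          hZc.intervalIntegrable]
      simp [Z, Λ]
    rw [hrhs]
    suffices hL : (innerSL ℝ (W t)).comp S = (innerSL ℝ y₁).comp S + (innerSL ℝ Z + Λ.comp S) by
      simpa using congrArg (fun L : G →L[ℝ] ℝ => L v) hL
    refine ContinuousLinearMap.ext_on (s := range g) ?_ ?_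
    · rw [dense_iff_closure_eq, ← Submodule.topologicalClosure_coe, g.dense_span]
      rfl
    · rintro _ ⟨i, rfl⟩
      change ⟪W t, S (g i)⟫_ℝ = ⟪y₁, S (g i)⟫_ℝ + (innerSL ℝ Z + Λ.comp S) (g i)
      rw [← hrhs, hS, inner_smul_right, hW t ht, (h i).vel t ht, mul_add, inner_smul_right,
        ← intervalIntegral.integral_const_mul]
      congr 1
      refine intervalIntegral.integral_congr fun τ hτ => ?_
      have h2 : ∫ ξ in (0 : ℝ)..τ, ⟪Y ξ, g i⟫_ℝ = ∫ ξ in (0 : ℝ)..τ, a i ξ :=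
        intervalIntegral.integral_congr fun ξ hξ => hY ξ (hsub τ (hsub t ht hτ) hξ) i
      have h3 : σ i * (σ i)⁻¹ = 1 := mul_inv_cancel₀ (hσ i).ne'
      rw [h2, hY τ (hsub t ht hτ), inner_smul_right]
      linear_combination (-a i τ + M * ∫ ξ in (0 : ℝ)..τ, a i ξ) * h3

theorem IsWeakSolution.sq_norm_add_le {ι : Type*} {S : G →L[ℝ] H} {e : HilbertBasis ι ℝ H}
    {g : HilbertBasis ι ℝ G} {σ : ι → ℝ} (hσ : ∀ i, 0 < σ i) (hS : ∀ i, S (g i) = σ i • e i)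
    {T M : ℝ} (hT : 0 ≤ T) {f : ℝ → H}
    (hfm : ∀ h : H, IntervalIntegrable (fun τ => ⟪f τ, h⟫_ℝ) volume 0 T)
    (hfsq : IntervalIntegrable (fun τ => ‖f τ‖ ^ 2) volume 0 T) {y₀ : G} {y₁ : H}
    {Y : ℝ → G} {W : ℝ → H} (h : IsWeakSolution S T M f y₀ y₁ Y W) {t : ℝ} (ht : t ∈ Icc 0 T) :
    ‖Y t‖ ^ 2 + ‖W t‖ ^ 2 ≤
      growthConst T M * (‖y₀‖ ^ 2 + ‖y₁‖ ^ 2 + ∫ τ in (0 : ℝ)..T, ‖f τ‖ ^ 2) := by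
  refine hasSum_le_of_sum_le ((g.hasSum_inner_sq (Y t)).add (e.hasSum_inner_sq (W t))) fun s => ?_
  calc _ ≤ ∑ i ∈ s, growthConst T M * (⟪y₀, g i⟫_ℝ ^ 2 + ⟪y₁, e i⟫_ℝ ^ 2 +
        ∫ τ in (0 : ℝ)..T, ⟪f τ, e i⟫_ℝ ^ 2) := by
        gcongr with i
        exact (h.isMode hσ hS i).sq_add_sq_le (hfm _)
          (intervalIntegrable_inner_sq hfm hfsq _) ht
    _ ≤ _ := by
        rw [← Finset.mul_sum]
        gcongr
        · exact (growthConst_pos T M).le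
        · exact sum_inner_sq_add_le hT hfm hfsq y₀ y₁ s

theorem IsWeakSolution.eqOn {ι : Type*} {S : G →L[ℝ] H} {e : HilbertBasis ι ℝ H}
    {g : HilbertBasis ι ℝ G} {σ : ι → ℝ} (hσ : ∀ i, 0 < σ i) (hS : ∀ i, S (g i) = σ i • e i)
    {T M : ℝ} {f : ℝ → H}
    (hfm : ∀ h : H, IntervalIntegrable (fun τ => ⟪f τ, h⟫_ℝ) volume 0 T) {y₀ : G} {y₁ : H}
    {Y Y' : ℝ → G} {W W' : ℝ → H} (h : IsWeakSolution S T M f y₀ y₁ Y W)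
    (h' : IsWeakSolution S T M f y₀ y₁ Y' W') : EqOn Y Y' (Icc 0 T) := fun _ ht =>
  g.ext_inner fun i => (h.isMode hσ hS i).eq (hfm _) (h'.isMode hσ hS i) ht

end AbstractWave

namespace FracWave

/-! ### A Poincaré inequality uniform in the order -/

theorem sq_toReal_eLpNorm_two {α : Type*} {m : MeasurableSpace α} {μ : Measure α} {f : α → ℝ}
    (hf : MemLp f 2 μ) : (eLpNorm f 2 μ).toReal ^ 2 = ∫ x, f x ^ 2 ∂μ := by
  rw [← Lp.norm_toLp f hf, ← real_inner_self_eq_norm_sq, L2.inner_def]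
  refine integral_congr_ae ?_
  filter_upwards [hf.coeFn_toLp] with x hx
  simp [hx, sq]

theorem measurable_zeroExt (v : L2) : Measurable (zeroExt v) :=
  ((Lp.stronglyMeasurable v).measurable).indicator measurableSet_Ioo

theorem zeroExt_of_notMem (v : L2) {x : ℝ} (hx : x ∉ dom) : zeroExt v x = 0 :=
  indicator_of_notMem hx _

theorem memLp_zeroExt (v : L2) : MemLp (zeroExt v) 2 volume :=
  (memLp_indicator_iff_restrict measurableSet_Ioo).2 (Lp.memLp v)

theorem eLpNorm_zeroExt (v : L2) :
    eLpNorm (zeroExt v) 2 volume = eLpNorm v 2 (volume.restrict dom) :=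
  eLpNorm_indicator_eq_eLpNorm_restrict measurableSet_Ioo

theorem memLp_translate {f : ℝ → ℝ} (hf : MemLp f 2 volume) (h : ℝ) :
    MemLp (fun x => f (x + h)) 2 volume :=
  hf.comp_measurePreserving (measurePreserving_add_right volume h)

/-- Translation by `n h` is the composition of `n` translations by `h`. -/
theorem eLpNorm_translate_sub_le {f : ℝ → ℝ} (hf : MemLp f 2 volume) (h : ℝ) (n : ℕ) :
    eLpNorm (fun x => f (x + n * h) - f x) 2 volume ≤
      n * eLpNorm (fun x => f (x + h) - f x) 2 volume := by
  induction n with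
  | zero => simp
  | succ n ih =>
    have hm : AEStronglyMeasurable (fun x => f (x + h) - f x) volume :=
      ((memLp_translate hf h).sub hf).aestronglyMeasurable
    have h1 : (fun x => f (x + (n + 1 : ℕ) * h) - f x) =
        ((fun x => f (x + h) - f x) ∘ fun x => x + n * h) + fun x => f (x + n * h) - f x := by
      funext x
      have : x + (n + 1 : ℕ) * h = x + n * h + h := by push_cast; ring
      simp only [Pi.add_apply, Function.comp_apply, this]
      ring
    have mp := measurePreserving_add_right (volume : Measure ℝ) (n * h)
    rw [h1]
    refine (eLpNorm_add_le (hm.comp_measurePreserving mp)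
      ((memLp_translate hf _).sub hf).aestronglyMeasurable (by norm_num)).trans ?_
    rw [eLpNorm_comp_measurePreserving hm mp]
    push_cast
    rw [add_mul, one_mul, add_comm]
    exact add_le_add ih le_rfl

/-- A translation by at least the width of the domain moves a function off its support. -/
theorem eLpNorm_le_eLpNorm_translate_sub (v : L2) {h : ℝ} (hh : 2 ≤ h) :
    eLpNorm (zeroExt v) 2 volume ≤ eLpNorm (fun x => zeroExt v (x + h) - zeroExt v x) 2 volume := by
  refine eLpNorm_mono fun x => ?_
  by_cases hx : x ∈ dom
  · have h1 : x + h ∉ dom := fun h2 => by linarith [hx.1, h2.2]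
    rw [zeroExt_of_notMem v h1, zero_sub, norm_neg]
  · rw [zeroExt_of_notMem v hx, norm_zero]
    exact norm_nonneg _

/-- The factor in the lower bound of the squared `L²` distance between a function supported in the
domain and its translate by `h > 0`. -/
def modulusWeight (h : ℝ) : ℝ := if h ≤ 2 then h ^ 2 / 16 else 1

theorem modulusWeight_mul_le (v : L2) {h : ℝ} (hh : 0 < h) :
    modulusWeight h * ‖v‖ ^ 2 ≤ ∫ x, (zeroExt v (x + h) - zeroExt v x) ^ 2 := by
  have hd : MemLp (fun x => zeroExt v (x + h) - zeroExt v x) 2 volume :=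
    (memLp_translate (memLp_zeroExt v) h).sub (memLp_zeroExt v)
  have key : ∀ n : ℕ, 2 ≤ n * h → ‖v‖ ^ 2 ≤
      (n : ℝ) ^ 2 * ∫ x, (zeroExt v (x + h) - zeroExt v x) ^ 2 := by
    intro n hn
    have h1 := (eLpNorm_le_eLpNorm_translate_sub v hn).trans
      (eLpNorm_translate_sub_le (memLp_zeroExt v) h n)
    have h2 := ENNReal.toReal_mono
      (ENNReal.mul_ne_top (ENNReal.natCast_ne_top n) hd.eLpNorm_ne_top) h1
    rw [ENNReal.toReal_mul, ENNReal.toReal_natCast, eLpNorm_zeroExt, ← Lp.norm_def] at h2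
    rw [← sq_toReal_eLpNorm_two hd, ← mul_pow]
    gcongr
  have hI : 0 ≤ ∫ x, (zeroExt v (x + h) - zeroExt v x) ^ 2 :=
    integral_nonneg fun _ => sq_nonneg _
  unfold modulusWeight
  split_ifs with h2
  -- the least number of steps of length `h` that leave the domain is at most `4 / h`
  · have h3 := key ⌈2 / h⌉₊ (by
      rw [← div_le_iff₀ hh]; exact Nat.le_ceil _)
    have h4 : (⌈2 / h⌉₊ : ℝ) * h ≤ 4 := by
      have h5 : (⌈2 / h⌉₊ : ℝ) < 2 / h + 1 := Nat.ceil_lt_add_one (by positivity)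
      have h6 : (2 / h + 1) * h = 2 + h := by field_simp
      nlinarith
    calc h ^ 2 / 16 * ‖v‖ ^ 2 ≤ h ^ 2 / 16 * ((⌈2 / h⌉₊ : ℝ) ^ 2 *
          ∫ x, (zeroExt v (x + h) - zeroExt v x) ^ 2) := by gcongr
      _ = ((⌈2 / h⌉₊ : ℝ) * h) ^ 2 / 16 * ∫ x, (zeroExt v (x + h) - zeroExt v x) ^ 2 := by ring
      _ ≤ 4 ^ 2 / 16 * ∫ x, (zeroExt v (x + h) - zeroExt v x) ^ 2 := by gcongr
      _ = _ := by norm_num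
  · have := key 1 (by push_cast; linarith)
    simpa using this

/-- The integrand of the Gagliardo seminorm. -/
def gagliardo (s : ℝ) (v : L2) (p : ℝ × ℝ) : ℝ :=
  (zeroExt v p.1 - zeroExt v p.2) ^ 2 / |p.1 - p.2| ^ (1 + 2 * s)

theorem gagliardo_nonneg (s : ℝ) (v : L2) (p : ℝ × ℝ) : 0 ≤ gagliardo s v p := by
  unfold gagliardo; positivity

theorem integrable_modulusWeight_mul_rpow {s : ℝ} (hs0 : 0 < s) (hs1 : s < 1) :
    IntegrableOn (fun h => modulusWeight h * h ^ (-(1 + 2 * s))) (Ioi 0) ∧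
    ∫ h in Ioi (0 : ℝ), modulusWeight h * h ^ (-(1 + 2 * s)) =
      (2 : ℝ) ^ (2 - 2 * s) / (16 * (2 - 2 * s)) + (2 : ℝ) ^ (-(2 * s)) / (2 * s) := by
  have e1 : EqOn (fun h : ℝ => modulusWeight h * h ^ (-(1 + 2 * s)))
      (fun h => h ^ (1 - 2 * s) / 16) (Ioc 0 2) := by
    intro h hh
    have : h ^ (1 - 2 * s) = h ^ 2 * h ^ (-(1 + 2 * s)) := by
      rw [← Real.rpow_natCast, ← Real.rpow_add hh.1]; congr 1; push_cast; ring
    simp only [modulusWeight, if_pos hh.2, this]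
    ring
  have e2 : EqOn (fun h : ℝ => modulusWeight h * h ^ (-(1 + 2 * s)))
      (fun h => h ^ (-(1 + 2 * s))) (Ioi 2) := by
    intro h hh
    simp only [modulusWeight, if_neg (not_le.2 (mem_Ioi.1 hh)), one_mul]
  have i1 : IntegrableOn (fun h : ℝ => h ^ (1 - 2 * s) / 16) (Ioc 0 2) :=
    ((intervalIntegrable_iff_integrableOn_Ioc_of_le (by norm_num)).1
      (intervalIntegral.intervalIntegrable_rpow' (by linarith))).div_const 16
  have i2 : IntegrableOn (fun h : ℝ => h ^ (-(1 + 2 * s))) (Ioi 2) :=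
    integrableOn_Ioi_rpow_of_lt (by linarith) (by norm_num)
  have j1 := (integrableOn_congr_fun e1 measurableSet_Ioc).2 i1
  have j2 := (integrableOn_congr_fun e2 measurableSet_Ioi).2 i2
  have hun : Ioi (0 : ℝ) = Ioc 0 2 ∪ Ioi 2 := (Ioc_union_Ioi_eq_Ioi (by norm_num)).symm
  refine ⟨by rw [hun]; exact j1.union j2, ?_⟩
  rw [hun, setIntegral_union (Ioc_disjoint_Ioi le_rfl) measurableSet_Ioi j1 j2,
    setIntegral_congr_fun measurableSet_Ioc e1, setIntegral_congr_fun measurableSet_Ioi e2,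
    integral_Ioi_rpow_of_lt (by linarith) (by norm_num), integral_div,
    ← intervalIntegral.integral_of_le (by norm_num), integral_rpow (Or.inl (by linarith)),
    Real.zero_rpow (by linarith)]
  have h1 : (1 : ℝ) - 2 * s + 1 = 2 - 2 * s := by ring
  have h2 : -(1 + 2 * s) + 1 = -(2 * s) := by ring
  rw [h1, h2, sub_zero, neg_div_neg_eq, div_div, mul_comm (2 - 2 * s)]

/-- The shear `(x,h) ↦ (x,x+h)` turns the Gagliardo seminorm into an integral over translations. -/
theorem le_integral_gagliardo {s : ℝ} (hs0 : 0 < s) (hs1 : s < 1) {v : L2} (hv : v ∈ H0s s) :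
    ((2 : ℝ) ^ (2 - 2 * s) / (16 * (2 - 2 * s)) + (2 : ℝ) ^ (-(2 * s)) / (2 * s)) * ‖v‖ ^ 2 ≤
      ∫ p, gagliardo s v p := by
  have hint : Integrable (gagliardo s v) (volume.prod volume) := hv
  have hmp : MeasurePreserving (MeasurableEquiv.shearAddRight ℝ)
      ((volume : Measure ℝ).prod volume) (volume.prod volume) := measurePreserving_prod_add _ _
  have hint' : Integrable (fun p => gagliardo s v (MeasurableEquiv.shearAddRight ℝ p))
      (volume.prod volume) := (hmp.integrable_comp_emb
        (MeasurableEquiv.measurableEmbedding _)).2 hint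
  have hval : ∀ h, ∫ x, gagliardo s v (MeasurableEquiv.shearAddRight ℝ (x, h)) =
      |h| ^ (-(1 + 2 * s)) * ∫ x, (zeroExt v (x + h) - zeroExt v x) ^ 2 := by
    intro h
    rw [← integral_const_mul]
    congr 1
    funext x
    have : (x - (x + h)) = -h := by ring
    change (zeroExt v x - zeroExt v (x + h)) ^ 2 / |x - (x + h)| ^ (1 + 2 * s) = _
    rw [this, abs_neg, Real.rpow_neg (abs_nonneg h), div_eq_inv_mul]
    ring
  have h2 := hint'.integral_prod_right
  have h1 : ∫ p, gagliardo s v p =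
      ∫ h, ∫ x, gagliardo s v (MeasurableEquiv.shearAddRight ℝ (x, h)) := by
    rw [← integral_prod_symm (fun p => gagliardo s v (MeasurableEquiv.shearAddRight ℝ p)) hint',
      hmp.integral_comp' (gagliardo s v)]
    rfl
  obtain ⟨w1, w2⟩ := integrable_modulusWeight_mul_rpow hs0 hs1
  rw [h1, ← w2, ← integral_mul_const]
  refine le_trans (setIntegral_mono_on (w1.mul_const _) h2.integrableOn measurableSet_Ioi
    fun h hh => ?_) (setIntegral_le_integral h2 (Eventually.of_forall fun h => ?_))
  · rw [hval, abs_of_pos hh, mul_right_comm, mul_comm]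
    have : 0 ≤ h ^ (-(1 + 2 * s)) := Real.rpow_nonneg (le_of_lt hh) _
    gcongr
    exact modulusWeight_mul_le v hh
  · exact integral_nonneg fun x => gagliardo_nonneg s v _

theorem normConst_pos {s : ℝ} (hs0 : 0 < s) (hs1 : s < 1) : 0 < normConst s := by
  have h1 := Real.Gamma_pos_of_pos (show 0 < (1 + 2 * s) / 2 by linarith)
  have h2 := Real.Gamma_pos_of_pos (show 0 < 1 - s by linarith)
  have := Real.pi_pos
  unfold normConst
  positivity

theorem form_self_eq (s : ℝ) (v : L2) : form s v v = normConst s / 2 * ∫ p, gagliardo s v p := by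
  unfold form gagliardo
  simp only [sq]

/-- The Poincaré inequality, uniform in `s`. The double integral is at least a multiple of
`4^{-s} ‖v‖² / (s (1 - s))`, and `C_s 4^{-s} / (s (1 - s)) = Γ(1/2 + s) / (√π Γ(2 - s))` is
continuous and positive on the closed interval `[0,1]`. -/
theorem exists_poincare :
    ∃ κ : ℝ, 0 < κ ∧ ∀ s : ℝ, 0 < s → s < 1 → ∀ v ∈ H0s s, κ * ‖v‖ ^ 2 ≤ form s v v := by
  have hg : ∀ x : ℝ, 0 < x → ContinuousAt Real.Gamma x := fun x hx =>
    (Real.differentiableAt_Gamma fun m h => by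
      have : (0 : ℝ) ≤ m := m.cast_nonneg
      linarith).continuousAt
  have hc : ContinuousOn (fun s : ℝ => Real.Gamma ((1 + 2 * s) / 2) /
      (16 * √Real.pi * Real.Gamma (2 - s))) (Icc 0 1) := by
    intro s hs
    apply ContinuousAt.continuousWithinAt
    have p1 : 0 < (1 + 2 * s) / 2 := by linarith [hs.1]
    have p2 : 0 < 2 - s := by linarith [hs.2]
    have c1 : ContinuousAt (fun s : ℝ => Real.Gamma ((1 + 2 * s) / 2)) s :=
      ContinuousAt.comp (f := fun s : ℝ => (1 + 2 * s) / 2) (hg _ p1) (by fun_prop)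
    have c2 : ContinuousAt (fun s : ℝ => Real.Gamma (2 - s)) s :=
      ContinuousAt.comp (f := fun s : ℝ => 2 - s) (hg _ p2) (by fun_prop)
    have := Real.Gamma_pos_of_pos p2
    have := Real.pi_pos
    exact c1.div (continuousAt_const.mul c2) (by positivity)
  obtain ⟨s₀, hs₀, hmin⟩ := isCompact_Icc.exists_isMinOn (nonempty_Icc.2 zero_le_one) hc
  refine ⟨Real.Gamma ((1 + 2 * s₀) / 2) / (16 * √Real.pi * Real.Gamma (2 - s₀)), ?_,
    fun s hs0 hs1 v hv => ?_⟩
  · have := Real.Gamma_pos_of_pos (show 0 < (1 + 2 * s₀) / 2 by linarith [hs₀.1])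
    have := Real.Gamma_pos_of_pos (show 0 < 2 - s₀ by linarith [hs₀.2])
    have := Real.pi_pos
    positivity
  · have hm := isMinOn_iff.1 hmin s ⟨hs0.le, hs1.le⟩
    have hN := normConst_pos hs0 hs1
    rw [form_self_eq]
    refine le_trans ?_ (mul_le_mul_of_nonneg_left (le_integral_gagliardo hs0 hs1 hv)
      (by positivity : 0 ≤ normConst s / 2))
    rw [← mul_assoc]
    refine mul_le_mul_of_nonneg_right (hm.trans ?_) (sq_nonneg _)
    have g1 := Real.Gamma_pos_of_pos (show 0 < (1 + 2 * s) / 2 by linarith)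
    have g2 := Real.Gamma_pos_of_pos (show 0 < 1 - s by linarith)
    have g3 : Real.Gamma (2 - s) = (1 - s) * Real.Gamma (1 - s) := by
      rw [← Real.Gamma_add_one (by linarith)]; congr 1; ring
    have e1 : (2 : ℝ) ^ (2 - 2 * s) = 4 * (2 : ℝ) ^ (-(2 * s)) := by
      rw [sub_eq_add_neg, Real.rpow_add (by norm_num)]; norm_num
    have e2 : (2 : ℝ) ^ (2 * s) * (2 : ℝ) ^ (-(2 * s)) = 1 := by
      rw [← Real.rpow_add (by norm_num)]; simp
    have hpi := Real.sqrt_pos.2 Real.pi_pos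
    have h1s : 0 < 1 - s := by linarith
    have e3 : normConst s / 2 * ((2 : ℝ) ^ (2 - 2 * s) / (16 * (2 - 2 * s)) +
        (2 : ℝ) ^ (-(2 * s)) / (2 * s)) = Real.Gamma ((1 + 2 * s) / 2) /
          (16 * √Real.pi * Real.Gamma (2 - s)) * (s + 4 * (1 - s)) := by
      have e4 : (2 : ℝ) ^ (2 - 2 * s) / (16 * (2 - 2 * s)) + (2 : ℝ) ^ (-(2 * s)) / (2 * s) =
          (2 : ℝ) ^ (-(2 * s)) * ((s + 4 * (1 - s)) / (8 * s * (1 - s))) := by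
        rw [e1]
        have : 2 - 2 * s ≠ 0 := by linarith
        field_simp
        ring
      calc _ = ((2 : ℝ) ^ (2 * s) * (2 : ℝ) ^ (-(2 * s))) * (s * Real.Gamma ((1 + 2 * s) / 2) /
            (√Real.pi * Real.Gamma (1 - s)) / 2 * ((s + 4 * (1 - s)) / (8 * s * (1 - s)))) := by
              rw [e4, normConst]; ring
        _ = _ := by rw [e2, g3]; field_simp; norm_num
    rw [e3]
    refine le_mul_of_one_le_right ?_ (by linarith)
    rw [g3]; positivity

/-! ### The energy space -/

open scoped InnerProductSpace

/-- The difference quotient of `v` whose `L²(ℝ²)` norm is the Gagliardo seminorm. -/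
def diffQuot (s : ℝ) (v : L2) (p : ℝ × ℝ) : ℝ :=
  (zeroExt v p.1 - zeroExt v p.2) / √(|p.1 - p.2| ^ (1 + 2 * s))

theorem measurable_diffQuot (s : ℝ) (v : L2) : Measurable (diffQuot s v) := by
  have := measurable_zeroExt v
  unfold diffQuot
  fun_prop

theorem diffQuot_mul (s : ℝ) (v w : L2) (p : ℝ × ℝ) : diffQuot s v p * diffQuot s w p =
    (zeroExt v p.1 - zeroExt v p.2) * (zeroExt w p.1 - zeroExt w p.2) /
      |p.1 - p.2| ^ (1 + 2 * s) := by
  unfold diffQuot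
  rw [div_mul_div_comm, Real.mul_self_sqrt (by positivity)]

theorem memLp_diffQuot_iff {s : ℝ} {v : L2} : MemLp (diffQuot s v) 2 volume ↔ v ∈ H0s s := by
  rw [memLp_two_iff_integrable_sq (measurable_diffQuot s v).aestronglyMeasurable]
  simp only [sq, diffQuot_mul, H0s, mem_ofPred_eq]

theorem memLp_diffQuot {s : ℝ} {v : L2} (hv : v ∈ H0s s) : MemLp (diffQuot s v) 2 volume :=
  memLp_diffQuot_iff.2 hv

theorem ae_prod_of_ae {P : ℝ → Prop} (h : ∀ᵐ x, P x) :
    ∀ᵐ p : ℝ × ℝ, P p.1 ∧ P p.2 :=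
  (Measure.quasiMeasurePreserving_fst.ae h).and (Measure.quasiMeasurePreserving_snd.ae h)

theorem ae_zeroExt_of_ae {v : L2} {f : ℝ → ℝ} (h : v =ᵐ[volume.restrict dom] f) :
    zeroExt v =ᵐ[volume] dom.indicator f := by
  filter_upwards [(ae_restrict_iff' measurableSet_Ioo).1 h] with x hx
  by_cases hxd : x ∈ dom
  · simp only [zeroExt, indicator_of_mem hxd, hx hxd]
  · simp only [zeroExt, indicator_of_notMem hxd]

theorem zeroExt_add (v w : L2) : zeroExt (v + w) =ᵐ[volume] fun x => zeroExt v x + zeroExt w x := by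
  refine (ae_zeroExt_of_ae (Lp.coeFn_add v w)).trans (Eventually.of_forall fun x => ?_)
  exact congrFun (indicator_add dom v w) x

theorem zeroExt_smul (c : ℝ) (v : L2) : zeroExt (c • v) =ᵐ[volume] fun x => c * zeroExt v x := by
  refine (ae_zeroExt_of_ae (Lp.coeFn_smul c v)).trans (Eventually.of_forall fun x => ?_)
  exact indicator_const_smul_apply dom c v x

theorem diffQuot_add (s : ℝ) (v w : L2) :
    diffQuot s (v + w) =ᵐ[volume] diffQuot s v + diffQuot s w := by
  filter_upwards [ae_prod_of_ae (zeroExt_add v w)] with p hp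
  simp only [diffQuot, Pi.add_apply, hp.1, hp.2]
  ring

theorem diffQuot_smul (s c : ℝ) (v : L2) : diffQuot s (c • v) =ᵐ[volume] c • diffQuot s v := by
  filter_upwards [ae_prod_of_ae (zeroExt_smul c v)] with p hp
  simp only [diffQuot, Pi.smul_apply, smul_eq_mul, hp.1, hp.2]
  ring

/-- `H_0^s` as a linear subspace of `L²(-1,1)`. -/
def H0sSubmodule (s : ℝ) : Submodule ℝ L2 where
  carrier := H0s s
  add_mem' {v w} hv hw := by
    rw [← memLp_diffQuot_iff] at *
    exact (memLp_congr_ae (diffQuot_add s v w)).2 (hv.add hw)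
  zero_mem' := by
    have h := diffQuot_smul s 0 0
    rw [zero_smul, zero_smul] at h
    exact memLp_diffQuot_iff.1 ((memLp_congr_ae h).2 MemLp.zero)
  smul_mem' c v hv := by
    rw [← memLp_diffQuot_iff] at *
    exact (memLp_congr_ae (diffQuot_smul s c v)).2 (hv.const_smul c)

/-- The normalized difference quotient, which turns the form into the inner product of `L²(ℝ²)`. -/
def energyMap (s : ℝ) : H0sSubmodule s →ₗ[ℝ] Lp ℝ 2 (volume : Measure (ℝ × ℝ)) where
  toFun v := √(normConst s / 2) • (memLp_diffQuot v.2).toLp (diffQuot s v)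
  map_add' v w := by
    rw [← smul_add, ← MemLp.toLp_add]
    exact congrArg _ (MemLp.toLp_congr _ _ (diffQuot_add s v w))
  map_smul' c v := by
    rw [RingHom.id_apply, smul_comm c]
    refine congrArg _ ?_
    rw [← MemLp.toLp_const_smul]
    exact MemLp.toLp_congr _ _ (diffQuot_smul s c v)

theorem inner_energyMap {s : ℝ} (hs0 : 0 < s) (hs1 : s < 1) (v w : H0sSubmodule s) :
    ⟪energyMap s v, energyMap s w⟫_ℝ = form s v w := by
  have hN := normConst_pos hs0 hs1
  change ⟪√(normConst s / 2) • (memLp_diffQuot v.2).toLp (diffQuot s v),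
    √(normConst s / 2) • (memLp_diffQuot w.2).toLp (diffQuot s w)⟫_ℝ = _
  rw [real_inner_smul_left, inner_smul_right, ← mul_assoc, Real.mul_self_sqrt (by positivity),
    L2.inner_def, form]
  congr 1
  refine integral_congr_ae ?_
  filter_upwards [(memLp_diffQuot v.2).coeFn_toLp, (memLp_diffQuot w.2).coeFn_toLp]
    with p h1 h2
  rw [h1, h2, ← diffQuot_mul]
  simp [mul_comm]

theorem exists_norm_le_energyMap : ∃ K : ℝ, 0 < K ∧ ∀ s : ℝ, 0 < s → s < 1 →
    ∀ v : H0sSubmodule s, ‖(v : L2)‖ ≤ K * ‖energyMap s v‖ := by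
  obtain ⟨κ, hκ, h⟩ := exists_poincare
  refine ⟨(√κ)⁻¹, by positivity, fun s hs0 hs1 v => ?_⟩
  have h1 := h s hs0 hs1 v v.2
  rw [← inner_energyMap hs0 hs1, real_inner_self_eq_norm_sq] at h1
  have h2 : √κ * ‖(v : L2)‖ ≤ ‖energyMap s v‖ := by
    refine le_of_sq_le_sq ?_ (norm_nonneg _)
    rwa [mul_pow, Real.sq_sqrt hκ.le]
  have := Real.sqrt_pos.2 hκ
  rw [inv_mul_eq_div, le_div_iff₀ this]
  linarith

theorem energyMap_injective {s : ℝ} (hs0 : 0 < s) (hs1 : s < 1) :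
    Function.Injective (energyMap s) := by
  obtain ⟨K, _, hK⟩ := exists_norm_le_energyMap
  rw [injective_iff_map_eq_zero]
  intro v hv
  have := hK s hs0 hs1 v
  rw [hv, norm_zero, mul_zero] at this
  exact Subtype.ext (norm_le_zero_iff.1 this)

/-- `H_0^s` with its own norm, realised as the space of the normalized difference quotients of its
elements in `L²(ℝ²)`. -/
abbrev energySpace (s : ℝ) : Submodule ℝ (Lp ℝ 2 (volume : Measure (ℝ × ℝ))) :=
  LinearMap.range (energyMap s)

/-- The embedding of `H_0^s`, with its own norm, into `L²(-1,1)`. -/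
def energyEmbedding {s : ℝ} (hs0 : 0 < s) (hs1 : s < 1) : energySpace s →L[ℝ] L2 :=
  LinearMap.mkContinuousOfExistsBound ((H0sSubmodule s).subtype ∘ₗ
    (LinearEquiv.ofInjective (energyMap s) (energyMap_injective hs0 hs1)).symm.toLinearMap) (by
      obtain ⟨K, _, hK⟩ := exists_norm_le_energyMap
      refine ⟨K, fun x => ?_⟩
      obtain ⟨v, rfl⟩ :=
        (LinearEquiv.ofInjective (energyMap s) (energyMap_injective hs0 hs1)).surjective x
      simpa using hK s hs0 hs1 v)

/-- The element of the energy space that belongs to a function of `H_0^s`. -/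
def toEnergy {s : ℝ} (v : H0sSubmodule s) : energySpace s := ⟨energyMap s v, v, rfl⟩

theorem exists_toEnergy_eq {s : ℝ} (x : energySpace s) : ∃ v : H0sSubmodule s, toEnergy v = x := by
  obtain ⟨v, hv⟩ := x.2
  exact ⟨v, Subtype.ext hv⟩

theorem energyEmbedding_toEnergy {s : ℝ} (hs0 : 0 < s) (hs1 : s < 1) (v : H0sSubmodule s) :
    energyEmbedding hs0 hs1 (toEnergy v) = v := by
  have : toEnergy v = LinearEquiv.ofInjective (energyMap s) (energyMap_injective hs0 hs1) v := rfl
  rw [this]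
  simp [energyEmbedding]

theorem energyEmbedding_mem {s : ℝ} (hs0 : 0 < s) (hs1 : s < 1) (x : energySpace s) :
    energyEmbedding hs0 hs1 x ∈ H0s s := by
  obtain ⟨v, rfl⟩ := exists_toEnergy_eq x
  rw [energyEmbedding_toEnergy]
  exact v.2

theorem form_energyEmbedding {s : ℝ} (hs0 : 0 < s) (hs1 : s < 1) (x y : energySpace s) :
    form s (energyEmbedding hs0 hs1 x) (energyEmbedding hs0 hs1 y) = ⟪x, y⟫_ℝ := by
  obtain ⟨v, rfl⟩ := exists_toEnergy_eq x
  obtain ⟨w, rfl⟩ := exists_toEnergy_eq y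
  rw [energyEmbedding_toEnergy, energyEmbedding_toEnergy, ← inner_energyMap hs0 hs1]
  rfl

theorem energyNorm_energyEmbedding {s : ℝ} (hs0 : 0 < s) (hs1 : s < 1) (x : energySpace s) :
    energyNorm s (energyEmbedding hs0 hs1 x) = ‖x‖ := by
  rw [energyNorm, form_energyEmbedding, real_inner_self_eq_norm_sq, Real.sqrt_sq (norm_nonneg _)]

theorem energyEmbedding_injective {s : ℝ} (hs0 : 0 < s) (hs1 : s < 1) :
    Function.Injective (energyEmbedding hs0 hs1) := by
  intro x y hxy
  obtain ⟨v, rfl⟩ := exists_toEnergy_eq x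
  obtain ⟨w, rfl⟩ := exists_toEnergy_eq y
  rw [energyEmbedding_toEnergy, energyEmbedding_toEnergy] at hxy
  rw [Subtype.ext hxy]

/-- The energy space is closed: along a sequence that converges in it, the functions converge in
`L²(-1,1)` by the Poincaré inequality, and almost everywhere along a subsequence. -/
theorem completeSpace_energySpace {s : ℝ} (hs0 : 0 < s) (hs1 : s < 1) :
    CompleteSpace (energySpace s) := by
  have hN := normConst_pos hs0 hs1
  have hc : 0 < √(normConst s / 2) := Real.sqrt_pos.2 (by positivity)
  refine IsClosed.completeSpace_coe (hs := IsSeqClosed.isClosed fun x u hx hxu => ?_)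
  set X : ℕ → energySpace s := fun n => ⟨x n, hx n⟩ with hX
  have hXc : CauchySeq X := Metric.cauchySeq_iff.2 fun ε hε => by
    obtain ⟨N, hN⟩ := Metric.cauchySeq_iff.1 hxu.cauchySeq ε hε
    exact ⟨N, fun m hm n hn => hN m hm n hn⟩
  choose w hw using fun n => exists_toEnergy_eq (X n)
  have hwx : ∀ n, energyMap s (w n) = x n := fun n => congrArg Subtype.val (hw n)
  have hwc : CauchySeq fun n => (w n : L2) := by
    have := (energyEmbedding hs0 hs1).uniformContinuous.comp_cauchySeq hXc
    simpa only [Function.comp_def, ← hw, energyEmbedding_toEnergy] using this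
  obtain ⟨v, hv⟩ := cauchySeq_tendsto_of_complete hwc
  obtain ⟨φ, hφ, hφv⟩ := (tendstoInMeasure_of_tendsto_Lp hv).exists_seq_tendsto_ae
  obtain ⟨ψ, hψ, hψu⟩ := (tendstoInMeasure_of_tendsto_Lp
    (hxu.comp hφ.tendsto_atTop)).exists_seq_tendsto_ae
  have hz : ∀ᵐ y : ℝ, Tendsto (fun i => zeroExt (w (φ (ψ i))) y) atTop (𝓝 (zeroExt v y)) := by
    filter_upwards [(ae_restrict_iff' measurableSet_Ioo).1 hφv] with y hy
    by_cases hyd : y ∈ dom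
    · simp only [zeroExt, indicator_of_mem hyd]
      exact (hy hyd).comp hψ.tendsto_atTop
    · simp only [zeroExt_of_notMem _ hyd]
      exact tendsto_const_nhds
  have hall : ∀ᵐ p : ℝ × ℝ, ∀ n, (x n : ℝ × ℝ → ℝ) p =
      √(normConst s / 2) * diffQuot s (w n) p := by
    rw [ae_all_iff]
    intro n
    rw [← hwx n]
    filter_upwards [Lp.coeFn_smul √(normConst s / 2)
      ((memLp_diffQuot (w n).2).toLp (diffQuot s (w n))),
      (memLp_diffQuot (w n).2).coeFn_toLp] with p h1 h2
    refine h1.trans ?_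
    rw [Pi.smul_apply, h2, smul_eq_mul]
  have hlim : (u : ℝ × ℝ → ℝ) =ᵐ[volume] √(normConst s / 2) • diffQuot s v := by
    filter_upwards [hψu, ae_prod_of_ae hz, hall] with p h1 h2 h3
    refine tendsto_nhds_unique h1 ?_
    simp only [Function.comp_apply, h3, Pi.smul_apply, smul_eq_mul, diffQuot]
    exact ((h2.1.sub h2.2).div_const _).const_mul _
  have hvm : v ∈ H0s s := by
    rw [← memLp_diffQuot_iff]
    have h1 := (memLp_congr_ae hlim).1 (Lp.memLp u)
    have h2 := h1.const_smul (√(normConst s / 2))⁻¹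
    rwa [smul_smul, inv_mul_cancel₀ hc.ne', one_smul] at h2
  refine ⟨⟨v, hvm⟩, ?_⟩
  refine Lp.ext ?_
  filter_upwards [hlim, Lp.coeFn_smul √(normConst s / 2)
      ((memLp_diffQuot hvm).toLp (diffQuot s v)),
      (memLp_diffQuot hvm).coeFn_toLp] with p h1 h2 h3
  refine h2.trans ?_
  rw [h1, Pi.smul_apply, Pi.smul_apply, h3]

/-! ### Compactness of the embedding -/

/-- The variance of a function on an interval as a double integral of its differences. -/
theorem integral_sub_const_sq_eq {V : ℝ → ℝ} (hV : MemLp V 2 volume) {a b : ℝ} (hab : a < b) :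
    ∫ x in Ioc a b, (V x - (∫ y in Ioc a b, V y) / (b - a)) ^ 2 =
      (∫ p in Ioc a b ×ˢ Ioc a b, (V p.1 - V p.2) ^ 2) / (2 * (b - a)) := by
  have hba : 0 < b - a := sub_pos.2 hab
  set μ := (volume : Measure ℝ).restrict (Ioc a b) with hμ
  have hfin : IsFiniteMeasure μ := inferInstance
  have hm : MemLp V 2 μ := hV.restrict _
  have hsq : Integrable (fun x => V x ^ 2) μ := hm.integrable_sq
  have hi : Integrable V μ := hm.integrable (by norm_num)
  have huniv : μ.real univ = b - a := by
    simp [hμ, measureReal_def, hab.le]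
  have hpr : (volume : Measure (ℝ × ℝ)).restrict (Ioc a b ×ˢ Ioc a b) = μ.prod μ :=
    (Measure.prod_restrict _ _).symm
  set A := ∫ x, V x ^ 2 ∂μ with hA
  set I := ∫ x, V x ∂μ with hI
  have h1 : ∫ x, (V x - I / (b - a)) ^ 2 ∂μ = A - I ^ 2 / (b - a) := by
    have e : ∀ x, (V x - I / (b - a)) ^ 2 =
        V x ^ 2 - 2 * (I / (b - a)) * V x + (I / (b - a)) ^ 2 := fun x => by ring
    simp only [e]
    have i1 : Integrable (fun x => V x ^ 2 - 2 * (I / (b - a)) * V x) μ := hsq.sub (hi.const_mul _)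
    rw [integral_add i1 (integrable_const _),
      integral_sub hsq (hi.const_mul _), integral_const_mul, integral_const, huniv, ← hA, ← hI,
      smul_eq_mul]
    field_simp
    ring
  have h2 : ∫ p, (V p.1 - V p.2) ^ 2 ∂(μ.prod μ) = 2 * (b - a) * A - 2 * I ^ 2 := by
    have e : ∀ p : ℝ × ℝ, (V p.1 - V p.2) ^ 2 =
        V p.1 ^ 2 * 1 + 1 * V p.2 ^ 2 - 2 * (V p.1 * V p.2) := fun p => by ring
    simp only [e]
    have i1 := hsq.mul_prod (integrable_const (μ := μ) (1 : ℝ))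
    have i2 := (integrable_const (μ := μ) (1 : ℝ)).mul_prod hsq
    have i3 : Integrable (fun p : ℝ × ℝ => V p.1 ^ 2 * 1 + 1 * V p.2 ^ 2) (μ.prod μ) := i1.add i2
    have k1 : ∫ p : ℝ × ℝ, V p.1 ^ 2 * 1 ∂(μ.prod μ) = A * (b - a) := by
      rw [integral_prod_mul (fun x => V x ^ 2) (fun _ => (1 : ℝ)), integral_const, huniv,
        smul_eq_mul, mul_one]
    have k2 : ∫ p : ℝ × ℝ, 1 * V p.2 ^ 2 ∂(μ.prod μ) = (b - a) * A := by
      rw [integral_prod_mul (fun _ => (1 : ℝ)) (fun x => V x ^ 2), integral_const, huniv,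
        smul_eq_mul, mul_one]
    have k3 : ∫ p : ℝ × ℝ, 2 * (V p.1 * V p.2) ∂(μ.prod μ) = 2 * (I * I) := by
      rw [integral_const_mul, integral_prod_mul]
    rw [integral_sub i3 ((hi.mul_prod hi).const_mul 2), integral_add i1 i2, k1, k2, k3]
    ring
  rw [hpr, h2, h1]
  field_simp

/-- On an interval, `|x - y| ≤ b - a` bounds the differences by the Gagliardo integrand. -/
theorem integral_cell_le {s : ℝ} (hs0 : 0 < s) {v : L2} (hv : v ∈ H0s s) {a b : ℝ} (hab : a < b) :
    ∫ x in Ioc a b, (zeroExt v x - (∫ y in Ioc a b, zeroExt v y) / (b - a)) ^ 2 ≤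
      (b - a) ^ (2 * s) * ∫ p in Ioc a b ×ˢ Ioc a b, gagliardo s v p := by
  have hba : 0 < b - a := sub_pos.2 hab
  rw [integral_sub_const_sq_eq (memLp_zeroExt v) hab]
  have hgi : Integrable (gagliardo s v) := hv
  have h1 : ∫ p in Ioc a b ×ˢ Ioc a b, (zeroExt v p.1 - zeroExt v p.2) ^ 2 ≤
      ∫ p in Ioc a b ×ˢ Ioc a b, (b - a) ^ (1 + 2 * s) * gagliardo s v p := by
    refine integral_mono_of_nonneg (Eventually.of_forall fun p => sq_nonneg _)
      (hgi.const_mul _).integrableOn ?_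
    filter_upwards [ae_restrict_mem (measurableSet_Ioc.prod measurableSet_Ioc)] with p hp
    unfold gagliardo
    rcases eq_or_ne p.1 p.2 with h | h
    · rw [h]; simp
    have hr : 0 < |p.1 - p.2| := abs_pos.2 (sub_ne_zero.2 h)
    have hle : |p.1 - p.2| ≤ b - a :=
      abs_sub_le_iff.2 ⟨by linarith [hp.1.2, hp.2.1], by linarith [hp.1.1, hp.2.2]⟩
    rw [mul_div_assoc', le_div_iff₀ (by positivity), mul_comm]
    gcongr
  rw [integral_const_mul, Real.rpow_add hba, Real.rpow_one] at h1
  have h3 : 0 ≤ ∫ p in Ioc a b ×ˢ Ioc a b, gagliardo s v p :=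
    integral_nonneg fun p => gagliardo_nonneg s v p
  rw [div_le_iff₀ (by positivity)]
  have h4 : 0 ≤ (b - a) ^ (2 * s) * ∫ p in Ioc a b ×ˢ Ioc a b, gagliardo s v p := by positivity
  nlinarith

/-- The `j`-th of the `N` cells of equal length that cover the domain. -/
def cell (N : ℕ) (j : ℕ) : Set ℝ := Ioc (-1 + 2 / N * j) (-1 + 2 / N * (j + 1 : ℕ))

theorem measurableSet_cell (N j : ℕ) : MeasurableSet (cell N j) := measurableSet_Ioc

theorem monotone_grid (N : ℕ) : Monotone fun j : ℕ => (-1 : ℝ) + 2 / N * j := by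
  intro i j hij
  beta_reduce
  gcongr

theorem pairwise_disjoint_cell (N : ℕ) : Pairwise (Function.onFun Disjoint (cell N)) :=
  (monotone_grid N).pairwise_disjoint_on_Ioc_succ

/-- The functions in `L²(-1,1)` that are constant on the `N` cells. -/
def stepSpace (N : ℕ) : Submodule ℝ L2 :=
  Submodule.span ℝ (range fun j : Fin N =>
    indicatorConstLp 2 (measurableSet_cell N j) (measure_ne_top _ _) (1 : ℝ))

instance finiteDimensional_stepSpace (N : ℕ) : FiniteDimensional ℝ (stepSpace N) :=
  FiniteDimensional.span_of_finite ℝ (finite_range _)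

/-- The approximation by the means over the cells. -/
theorem exists_stepSpace_norm_sub_le {s : ℝ} (hs0 : 0 < s) {v : L2} (hv : v ∈ H0s s) {N : ℕ}
    (hN : 0 < N) : ∃ q ∈ stepSpace N,
      ‖v - q‖ ^ 2 ≤ (2 / N : ℝ) ^ (2 * s) * ∫ p, gagliardo s v p := by
  have hN' : (0 : ℝ) < N := Nat.cast_pos.2 hN
  set m : ℕ → ℝ := fun j => (∫ y in cell N j, zeroExt v y) / (2 / N) with hm
  set q : L2 := ∑ j : Fin N, m j •
    indicatorConstLp 2 (measurableSet_cell N j) (measure_ne_top _ _) (1 : ℝ) with hq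
  have hmem : q ∈ stepSpace N := Submodule.sum_mem _ fun j _ =>
    Submodule.smul_mem _ _ (Submodule.subset_span ⟨j, rfl⟩)
  refine ⟨q, hmem, ?_⟩
  -- the pointwise form of `v - q` on a cell
  have hqc : q =ᵐ[volume.restrict dom] fun x => ∑ j : Fin N, m j * (cell N j).indicator 1 x := by
    have h1 : ∀ᵐ x ∂(volume.restrict dom), ∀ j : Fin N, (m j •
        indicatorConstLp (μ := volume.restrict dom) 2 (measurableSet_cell N j)
          (measure_ne_top _ _) (1 : ℝ) : L2) x = m j * (cell N j).indicator 1 x := by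
      rw [ae_all_iff]
      intro j
      filter_upwards [Lp.coeFn_smul (m j) (indicatorConstLp (μ := volume.restrict dom) 2
        (measurableSet_cell N j) (measure_ne_top _ _) (1 : ℝ)),
        indicatorConstLp_coeFn (p := 2) (μ := volume.restrict dom) (hs := measurableSet_cell N j)
          (hμs := measure_ne_top _ _) (c := (1 : ℝ))] with x hx1 hx2
      rw [hx1, Pi.smul_apply, hx2, smul_eq_mul]
      rfl
    filter_upwards [h1, Lp.coeFn_fun_finsetSum Finset.univ (fun j : Fin N => (m j •
        indicatorConstLp (μ := volume.restrict dom) 2 (measurableSet_cell N j)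
          (measure_ne_top _ _) (1 : ℝ) : L2))] with x hx1 hx2
    rw [hq, hx2]
    exact Finset.sum_congr rfl fun j _ => hx1 j
  have hcell : ∀ j < N, ∀ x ∈ cell N j, ∑ i : Fin N, m i * (cell N i).indicator 1 x = m j := by
    intro j hj x hx
    rw [Finset.sum_eq_single ⟨j, hj⟩]
    · simp [hx]
    · intro i _ hij
      have hne : (i : ℕ) ≠ j := fun h => hij (Fin.ext h)
      rw [indicator_of_notMem, mul_zero]
      exact fun hxi => (pairwise_disjoint_cell N hne).le_bot ⟨hxi, hx⟩
    · intro h; exact absurd (Finset.mem_univ _) h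
  set F : ℝ → ℝ := fun x => (zeroExt v x - ∑ j : Fin N, m j * (cell N j).indicator 1 x) ^ 2 with hF
  have hvq : ‖v - q‖ ^ 2 = ∫ x in dom, F x := by
    rw [← real_inner_self_eq_norm_sq, L2.inner_def]
    refine integral_congr_ae ?_
    filter_upwards [Lp.coeFn_sub v q, hqc, ae_restrict_mem measurableSet_Ioo] with x h1 h2 h3
    rw [h1, Pi.sub_apply, h2, hF]
    simp only [zeroExt, indicator_of_mem h3]
    simp [sq]
  have hFi : Integrable F := by
    have hstep : MemLp (fun x => ∑ j : Fin N, m j * (cell N j).indicator 1 x) 2 volume := by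
      refine memLp_finsetSum _ fun j _ => ?_
      exact ((memLp_indicator_const 2 (measurableSet_cell N j) (1 : ℝ)
        (Or.inr (by simp [cell]))).const_mul (m j))
    exact ((memLp_zeroExt v).sub hstep).integrable_sq
  have hsplit : ∫ x in dom, F x = ∑ j ∈ Finset.range N, ∫ x in cell N j, F x := by
    have h1 := intervalIntegral.sum_integral_adjacent_intervals (f := F) (μ := volume)
      (a := fun j : ℕ => (-1 : ℝ) + 2 / N * j) (n := N) (fun _ _ => hFi.intervalIntegrable)
    have h2 : (-1 : ℝ) + 2 / N * N = 1 := by field_simp; norm_num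
    simp only [Nat.cast_zero, mul_zero, add_zero, h2] at h1
    rw [Measure.restrict_congr_set Ioo_ae_eq_Ioc, ← intervalIntegral.integral_of_le (by norm_num),
      ← h1]
    refine Finset.sum_congr rfl fun j _ => ?_
    rw [intervalIntegral.integral_of_le (monotone_grid N (Nat.le_succ j))]
    rfl
  have hlen : ∀ j : ℕ, (-1 + 2 / N * (j + 1 : ℕ) : ℝ) - (-1 + 2 / N * j) = 2 / N := by
    intro j; push_cast; ring
  have hgi : Integrable (gagliardo s v) := hv
  calc ‖v - q‖ ^ 2 = ∑ j ∈ Finset.range N, ∫ x in cell N j, F x := by rw [hvq, hsplit]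
    _ ≤ ∑ j ∈ Finset.range N,
        (2 / N : ℝ) ^ (2 * s) * ∫ p in cell N j ×ˢ cell N j, gagliardo s v p := by
      refine Finset.sum_le_sum fun j hj => ?_
      have hlt : (-1 + 2 / N * j : ℝ) < -1 + 2 / N * (j + 1 : ℕ) := by
        have : (0 : ℝ) < 2 / N := by positivity
        linarith [hlen j]
      have h1 := integral_cell_le hs0 hv hlt
      rw [hlen] at h1
      refine le_trans (le_of_eq ?_) h1
      refine setIntegral_congr_fun (measurableSet_cell N j) fun x hx => ?_
      simp only [hF, hcell j (Finset.mem_range.1 hj) x hx]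
      rfl
    _ = (2 / N : ℝ) ^ (2 * s) *
        ∫ p in ⋃ j ∈ Finset.range N, cell N j ×ˢ cell N j, gagliardo s v p := by
      rw [← Finset.mul_sum, integral_biUnion_finset _
        (fun j _ => (measurableSet_cell N j).prod (measurableSet_cell N j)) _
        (fun j _ => hgi.integrableOn)]
      intro i _ j _ hij
      exact Disjoint.set_prod_left (pairwise_disjoint_cell N hij) _ _
    _ ≤ _ := by
      exact mul_le_mul_of_nonneg_left
        (setIntegral_le_integral hgi (Eventually.of_forall (gagliardo_nonneg s v))) (by positivity)

/-- The embedding is the norm limit of its compositions with the orthogonal projections onto the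
step functions. -/
theorem isCompactOperator_energyEmbedding {s : ℝ} (hs0 : 0 < s) (hs1 : s < 1) :
    IsCompactOperator (energyEmbedding hs0 hs1) := by
  have hC := normConst_pos hs0 hs1
  set S := energyEmbedding hs0 hs1 with hS
  have hlim : Tendsto (fun N : ℕ => √((2 / N : ℝ) ^ (2 * s) * (2 / normConst s))) atTop (𝓝 0) := by
    have h1 : Tendsto (fun N : ℕ => (2 / N : ℝ)) atTop (𝓝 0) :=
      tendsto_const_div_atTop_nhds_zero_nat 2
    have h2 := ((h1.rpow_const (p := 2 * s) (Or.inr (by positivity))).mul_const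
      (2 / normConst s)).sqrt
    simpa [Real.zero_rpow (by positivity : 2 * s ≠ 0)] using h2
  refine isCompactOperator_of_tendsto (l := atTop)
    (F := fun N : ℕ => (stepSpace N).starProjection ∘L S) ?_ (Eventually.of_forall fun N => ?_)
  · refine (tendsto_iff_norm_sub_tendsto_zero (E := energySpace s →L[ℝ] L2)).2 ?_
    refine squeeze_zero' (Eventually.of_forall fun _ => ContinuousLinearMap.opNorm_nonneg _) ?_ hlim
    filter_upwards [eventually_gt_atTop 0] with N hN
    refine ContinuousLinearMap.opNorm_le_bound _ (Real.sqrt_nonneg _) fun x => ?_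
    have hmem := energyEmbedding_mem hs0 hs1 x
    obtain ⟨q, hq, hle⟩ := exists_stepSpace_norm_sub_le hs0 hmem hN
    have hgag : ∫ p, gagliardo s (S x) p = 2 / normConst s * ‖x‖ ^ 2 := by
      have h1 := form_energyEmbedding hs0 hs1 x x
      rw [form_self_eq, real_inner_self_eq_norm_sq] at h1
      rw [hS, ← h1]
      field_simp
    have hmin : ‖S x - (stepSpace N).starProjection (S x)‖ ≤ ‖S x - q‖ := by
      rw [Submodule.starProjection_minimal]
      exact ciInf_le ⟨0, by rintro _ ⟨y, rfl⟩; exact norm_nonneg _⟩ (⟨q, hq⟩ : stepSpace N)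
    rw [← hS, hgag, ← mul_assoc] at hle
    change ‖(stepSpace N).starProjection (S x) - S x‖ ≤ _
    rw [norm_sub_rev]
    refine hmin.trans ?_
    rw [← Real.sqrt_sq (norm_nonneg x), ← Real.sqrt_mul (by positivity)]
    exact Real.le_sqrt_of_sq_le hle
  · have : ProperSpace (stepSpace N) := FiniteDimensional.proper ℝ _
    have h1 : IsCompactOperator ((stepSpace N).orthogonalProjectionOnto ∘L S) :=
      isCompactOperator_of_locallyCompactSpace_dom _
    exact h1.clm_comp (stepSpace N).subtypeL

/-! ### Density of the energy space -/

theorem integrable_comp_abs {f : ℝ → ℝ} (hf : IntegrableOn f (Ioi 0)) :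
    Integrable fun x => f |x| := by
  have h1 : IntegrableOn (fun x => f |x|) (Ioi 0) :=
    (integrableOn_congr_fun (fun x hx => by rw [abs_of_pos hx]) measurableSet_Ioi).2 hf
  have h2 : IntegrableOn (fun x => f |x|) (Iic 0) := by
    rw [← Measure.map_neg_eq_self (volume : Measure ℝ)]
    let m : MeasurableEmbedding fun x : ℝ => -x := (Homeomorph.neg ℝ).measurableEmbedding
    rw [m.integrableOn_map_iff]
    simp_rw [Function.comp_def, abs_neg, neg_preimage, neg_Iic, neg_zero]
    exact Iff.mpr integrableOn_Ici_iff_integrableOn_Ioi h1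
  rw [← integrableOn_univ, ← Iic_union_Ioi (a := (0 : ℝ))]
  exact h2.union h1

/-- A Lipschitz function that vanishes outside the domain has finite Gagliardo seminorm; this is
where `s < 1` enters. -/
theorem integrable_gagliardo_of_lipschitz {s : ℝ} (hs0 : 0 < s) (hs1 : s < 1) {g : ℝ → ℝ}
    {L B : ℝ} (hL : ∀ x y, |g x - g y| ≤ L * |x - y|) (hB : ∀ x, |g x| ≤ B)
    (hgm : Measurable g) (hg0 : ∀ x ∉ dom, g x = 0) :
    Integrable fun p : ℝ × ℝ => (g p.1 - g p.2) ^ 2 / |p.1 - p.2| ^ (1 + 2 * s) := by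
  set θ : ℝ → ℝ := fun r => if r ≤ 1 then L ^ 2 * r ^ (1 - 2 * s) else
    (2 * B) ^ 2 * r ^ (-(1 + 2 * s)) with hθ
  have hθi : IntegrableOn θ (Ioi 0) := by
    rw [← Ioc_union_Ioi_eq_Ioi (zero_le_one (α := ℝ))]
    refine IntegrableOn.union ?_ ?_
    · refine (integrableOn_congr_fun (fun r hr => ?_) measurableSet_Ioc).2
        (((intervalIntegrable_iff_integrableOn_Ioc_of_le zero_le_one).1
          (intervalIntegral.intervalIntegrable_rpow' (r := 1 - 2 * s) (by linarith))).const_mul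
            (L ^ 2))
      simp only [hθ, if_pos hr.2]
    · refine (integrableOn_congr_fun (fun r hr => ?_) measurableSet_Ioi).2
        ((integrableOn_Ioi_rpow_of_lt (a := -(1 + 2 * s)) (by linarith) zero_lt_one).const_mul
          ((2 * B) ^ 2))
      simp only [hθ, if_neg (not_le.2 (mem_Ioi.1 hr))]
  have hθ0 : ∀ r, 0 ≤ r → 0 ≤ θ r := by
    intro r hr
    simp only [hθ]
    split_ifs <;> positivity
  have hind : Integrable (dom.indicator (1 : ℝ → ℝ)) := by
    rw [integrable_indicator_iff measurableSet_Ioo]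
    exact integrableOn_const (by simp)
  have hmp : MeasurePreserving (MeasurableEquiv.shearAddRight ℝ)
      ((volume : Measure ℝ).prod volume) (volume.prod volume) := measurePreserving_prod_add _ _
  -- the integrand vanishes unless `p.1` or `p.2` lies in the domain
  have hd1 : Integrable (fun p : ℝ × ℝ => dom.indicator (1 : ℝ → ℝ) p.1 * θ |p.2 - p.1|)
      (volume.prod volume) := by
    rw [← hmp.integrable_comp_emb (MeasurableEquiv.measurableEmbedding _)]
    refine (hind.mul_prod (integrable_comp_abs hθi)).congr (Eventually.of_forall fun p => ?_)
    change _ = dom.indicator 1 p.1 * θ |p.1 + p.2 - p.1|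
    rw [add_sub_cancel_left]
  have hd2 := hd1.swap
  refine (hd1.add hd2).mono' ?_ (Eventually.of_forall fun p => ?_)
  · exact (by fun_prop : Measurable fun p : ℝ × ℝ =>
      (g p.1 - g p.2) ^ 2 / |p.1 - p.2| ^ (1 + 2 * s)).aestronglyMeasurable
  · rw [Real.norm_of_nonneg (by positivity)]
    have hbound : (g p.1 - g p.2) ^ 2 / |p.1 - p.2| ^ (1 + 2 * s) ≤ θ |p.1 - p.2| := by
      rcases eq_or_ne p.1 p.2 with h | h
      · rw [h]; simpa using hθ0 0 le_rfl
      have hr : 0 < |p.1 - p.2| := abs_pos.2 (sub_ne_zero.2 h)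
      rw [div_le_iff₀ (by positivity)]
      simp only [hθ]
      split_ifs
      · rw [mul_assoc, ← Real.rpow_add hr]
        have : (1 - 2 * s + (1 + 2 * s)) = (2 : ℕ) := by push_cast; ring
        rw [this, Real.rpow_natCast, ← mul_pow, ← sq_abs]
        gcongr
        exact hL _ _
      · rw [mul_assoc, ← Real.rpow_add hr, neg_add_cancel, Real.rpow_zero, mul_one, ← sq_abs]
        gcongr
        exact (abs_sub _ _).trans (by linarith [hB p.1, hB p.2])
    have hsymm : θ |p.2 - p.1| = θ |p.1 - p.2| := by rw [abs_sub_comm]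
    have hθp := hθ0 _ (abs_nonneg (p.1 - p.2))
    change _ ≤ dom.indicator (1 : ℝ → ℝ) p.1 * θ |p.2 - p.1| +
      dom.indicator (1 : ℝ → ℝ) p.2 * θ |p.1 - p.2|
    rw [hsymm]
    by_cases h1 : p.1 ∈ dom
    · rw [indicator_of_mem h1, Pi.one_apply, one_mul]
      have : 0 ≤ dom.indicator (1 : ℝ → ℝ) p.2 := indicator_nonneg (fun _ _ => zero_le_one) _
      nlinarith [mul_nonneg this hθp]
    · by_cases h2 : p.2 ∈ dom
      · rw [indicator_of_notMem h1, indicator_of_mem h2, Pi.one_apply]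
        linarith
      · rw [indicator_of_notMem h1, indicator_of_notMem h2, hg0 _ h1, hg0 _ h2]
        simp

/-- `H_0^s` is dense in `L²(-1,1)`: it contains the smooth functions compactly supported in
`(-1,1)`. -/
theorem eq_zero_of_forall_inner_H0s {s : ℝ} (hs0 : 0 < s) (hs1 : s < 1) {h : L2}
    (hh : ∀ v ∈ H0s s, ⟪h, v⟫_ℝ = 0) : h = 0 := by
  have key : ∀ᵐ x, x ∈ dom → (h : ℝ → ℝ) x = 0 := by
    refine isOpen_Ioo.ae_eq_zero_of_integral_contDiff_smul_eq_zero ?_ fun g hg hgc hgs => ?_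
    · have : IntegrableOn h dom := (Lp.memLp h).integrable (by norm_num)
      exact this.locallyIntegrableOn
    · obtain ⟨L, hL⟩ := hg.lipschitzWith_of_hasCompactSupport hgc (by simp)
      obtain ⟨B, hB⟩ := hgc.exists_bound_of_continuous hg.continuous
      have hg0 : ∀ x ∉ dom, g x = 0 := fun x hx =>
        image_eq_zero_of_notMem_tsupport fun hx' => hx (hgs hx')
      have hgm : MemLp g 2 (volume.restrict dom) :=
        (hg.continuous.memLp_of_hasCompactSupport hgc).restrict _
      have hz : zeroExt (hgm.toLp g) =ᵐ[volume] g := by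
        refine (ae_zeroExt_of_ae hgm.coeFn_toLp).trans (Eventually.of_forall fun x => ?_)
        by_cases hx : x ∈ dom
        · exact indicator_of_mem hx g
        · rw [indicator_of_notMem hx, hg0 x hx]
      have hmem : hgm.toLp g ∈ H0s s := by
        refine (integrable_gagliardo_of_lipschitz hs0 hs1 (L := L) (B := B) (fun x y => ?_)
          (fun x => hB x) hg.continuous.measurable hg0).congr ?_
        · simpa [Real.dist_eq] using hL.dist_le_mul x y
        · filter_upwards [ae_prod_of_ae hz] with p hp
          rw [hp.1, hp.2]
      have h1 := hh _ hmem
      rw [L2.inner_def] at h1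
      rw [← h1, ← setIntegral_eq_integral_of_forall_compl_eq_zero (s := dom)
        (fun x hx => by rw [hg0 x hx, zero_smul])]
      refine integral_congr_ae ?_
      filter_upwards [hgm.coeFn_toLp] with x hx
      rw [hx]
      simp
  refine Lp.ext ?_
  filter_upwards [(ae_restrict_iff' measurableSet_Ioo).2 key, Lp.coeFn_zero ℝ 2
    (volume.restrict dom)] with x h1 h2
  rw [h1, h2, Pi.zero_apply]

/-! ### The control as a forcing term -/

theorem measurableSet_controlRegion (T : ℝ) {ω₀ : Set ℝ} (hω : IsOpen ω₀) (c : ℝ) :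
    MeasurableSet (controlRegion T ω₀ c) := by
  have h1 : MeasurableSet {p : ℝ × ℝ | p.1 ∈ Ioo 0 T} := measurable_fst measurableSet_Ioo
  have h2 : MeasurableSet {p : ℝ × ℝ | p.2 + c * p.1 ∈ ω₀} :=
    (by fun_prop : Measurable fun p : ℝ × ℝ => p.2 + c * p.1) hω.measurableSet
  exact h1.inter h2

variable {T c : ℝ} {ω₀ : Set ℝ}

/-- The control, extended by zero outside its region. -/
def controlExt (u : Control T ω₀ c) : ℝ × ℝ → ℝ := (controlRegion T ω₀ c).indicator u

theorem measurable_controlExt (hω : IsOpen ω₀) (u : Control T ω₀ c) : Measurable (controlExt u) :=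
  ((Lp.stronglyMeasurable u).measurable).indicator (measurableSet_controlRegion T hω c)

theorem memLp_controlExt (hω : IsOpen ω₀) (u : Control T ω₀ c) :
    MemLp (controlExt u) 2 volume :=
  (memLp_indicator_iff_restrict (measurableSet_controlRegion T hω c)).2 (Lp.memLp u)

theorem integral_controlExt_sq (hω : IsOpen ω₀) (u : Control T ω₀ c) :
    ∫ p, controlExt u p ^ 2 = ‖u‖ ^ 2 := by
  rw [← sq_toReal_eLpNorm_two (memLp_controlExt hω u), Lp.norm_def]
  congr 2
  exact eLpNorm_indicator_eq_eLpNorm_restrict (measurableSet_controlRegion T hω c)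

theorem indicator_movingSet_eq (u : Control T ω₀ c) {τ : ℝ} (hτ : τ ∈ Ioo 0 T) (x : ℝ) :
    (movingSet ω₀ c τ).indicator (fun z => u (τ, z)) x = controlExt u (τ, x) := by
  by_cases hx : x ∈ movingSet ω₀ c τ
  · rw [indicator_of_mem hx, controlExt, indicator_of_mem]
    exact ⟨hτ, hx⟩
  · rw [indicator_of_notMem hx, controlExt, indicator_of_notMem]
    exact fun h => hx h.2

open Classical in
/-- The forcing `τ ↦ 1_{ω(τ)} u(τ)` with values in `L²(-1,1)`; it is `0` at the exceptional times at
which the time slice of the control is not square integrable. -/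
def forcing (u : Control T ω₀ c) (τ : ℝ) : L2 :=
  if h : MemLp (fun x => controlExt u (τ, x)) 2 (volume.restrict dom) then h.toLp _ else 0

theorem ae_coeFn_forcing (hω : IsOpen ω₀) (u : Control T ω₀ c) :
    ∀ᵐ τ : ℝ, forcing u τ =ᵐ[volume.restrict dom] fun x => controlExt u (τ, x) := by
  have h1 : Integrable (fun p => controlExt u p ^ 2) (volume.prod volume) :=
    (memLp_controlExt hω u).integrable_sq
  filter_upwards [h1.prod_right_ae] with τ hτ
  have hm : MemLp (fun x => controlExt u (τ, x)) 2 (volume.restrict dom) := by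
    rw [memLp_two_iff_integrable_sq]
    · exact hτ.restrict
    · exact ((measurable_controlExt hω u).comp measurable_prodMk_left).aestronglyMeasurable
  rw [forcing, dif_pos hm]
  exact hm.coeFn_toLp

theorem ae_inner_forcing (hω : IsOpen ω₀) (u : Control T ω₀ c) :
    ∀ᵐ τ : ℝ, ∀ v : L2, ⟪forcing u τ, v⟫_ℝ = ∫ x in dom, controlExt u (τ, x) * v x := by
  filter_upwards [ae_coeFn_forcing hω u] with τ hτ v
  rw [L2.inner_def]
  refine integral_congr_ae ?_
  filter_upwards [hτ] with x hx
  rw [hx]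
  simp [mul_comm]

theorem ae_norm_forcing_sq (hω : IsOpen ω₀) (u : Control T ω₀ c) :
    ∀ᵐ τ : ℝ, ‖forcing u τ‖ ^ 2 = ∫ x in dom, controlExt u (τ, x) ^ 2 := by
  filter_upwards [ae_coeFn_forcing hω u] with τ hτ
  rw [← real_inner_self_eq_norm_sq, L2.inner_def]
  refine integral_congr_ae ?_
  filter_upwards [hτ] with x hx
  rw [hx]
  simp [sq]

theorem integrable_norm_forcing_sq (hω : IsOpen ω₀) (u : Control T ω₀ c) :
    Integrable fun τ => ‖forcing u τ‖ ^ 2 := by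
  have h1 : Integrable (fun p => controlExt u p ^ 2) (volume.prod (volume.restrict dom)) :=
    Integrable.mono_measure (memLp_controlExt hω u).integrable_sq
      (Measure.prod_mono le_rfl Measure.restrict_le_self)
  refine h1.integral_prod_left.congr ?_
  filter_upwards [ae_norm_forcing_sq hω u] with τ hτ using hτ.symm

theorem integral_norm_forcing_sq_le (hT : 0 ≤ T) (hω : IsOpen ω₀) (u : Control T ω₀ c) :
    ∫ τ in (0 : ℝ)..T, ‖forcing u τ‖ ^ 2 ≤ ‖u‖ ^ 2 := by
  have h1 : Integrable (fun p => controlExt u p ^ 2) (volume.prod volume) :=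
    (memLp_controlExt hω u).integrable_sq
  rw [intervalIntegral.integral_of_le hT]
  calc _ ≤ ∫ τ, ‖forcing u τ‖ ^ 2 := setIntegral_le_integral (integrable_norm_forcing_sq hω u)
        (Eventually.of_forall fun _ => sq_nonneg _)
    _ ≤ ∫ τ, ∫ x, controlExt u (τ, x) ^ 2 := by
      refine integral_mono_ae (integrable_norm_forcing_sq hω u) h1.integral_prod_left ?_
      filter_upwards [ae_norm_forcing_sq hω u, h1.prod_right_ae] with τ h2 h3
      rw [h2]
      exact setIntegral_le_integral h3 (Eventually.of_forall fun _ => sq_nonneg _)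
    _ = ‖u‖ ^ 2 := by
      rw [← integral_controlExt_sq hω u]
      exact (integral_prod _ h1).symm

theorem integrable_inner_forcing (hω : IsOpen ω₀) (u : Control T ω₀ c) (v : L2) (t : ℝ) :
    IntervalIntegrable (fun τ => ⟪forcing u τ, v⟫_ℝ) volume 0 t := by
  have hm : AEStronglyMeasurable (fun τ => ⟪forcing u τ, v⟫_ℝ) volume := by
    have h1 : StronglyMeasurable
        (Function.uncurry fun (τ x : ℝ) => controlExt u (τ, x) * (v : ℝ → ℝ) x) := by
      have h2 := (Lp.stronglyMeasurable v).measurable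
      have h3 := measurable_controlExt hω u
      exact ((h3.mul (h2.comp measurable_snd))).stronglyMeasurable
    refine (h1.integral_prod_right (ν := volume.restrict dom)).aestronglyMeasurable.congr ?_
    filter_upwards [ae_inner_forcing hω u] with τ hτ using (hτ v).symm
  have hb : IntervalIntegrable (fun τ => (1 + ‖forcing u τ‖ ^ 2) * ‖v‖) volume 0 t :=
    (intervalIntegrable_const.add (integrable_norm_forcing_sq hω u).intervalIntegrable).mul_const _
  refine hb.mono_fun hm.restrict (Eventually.of_forall fun τ => ?_)
  beta_reduce
  rw [Real.norm_of_nonneg (by positivity : 0 ≤ (1 + ‖forcing u τ‖ ^ 2) * ‖v‖)]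
  refine (abs_real_inner_le_norm _ _).trans ?_
  gcongr
  nlinarith [sq_nonneg (‖forcing u τ‖ - 1)]

/-! ### Solutions of the wave equation and solutions in the energy space -/

variable {s M : ℝ}

/-- The right-hand sides of the two weak formulations agree; the slices of the control agree with
the forcing at almost every time only. -/
theorem weak_rhs_eq (hs0 : 0 < s) (hs1 : s < 1) (hω : IsOpen ω₀) (u : Control T ω₀ c)
    {y : ℝ → L2} {Y : ℝ → energySpace s}
    (hy : ∀ t ∈ Icc 0 T, y t = energyEmbedding hs0 hs1 (Y t)) (x : energySpace s)
    {t : ℝ} (ht : t ∈ Icc 0 T) :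
    ∫ τ in (0 : ℝ)..t, (-form s (y τ) (energyEmbedding hs0 hs1 x) +
        M * (∫ r in (0 : ℝ)..τ, form s (y r) (energyEmbedding hs0 hs1 x)) +
        ∫ z in dom, (movingSet ω₀ c τ).indicator (fun z => u (τ, z)) z *
          energyEmbedding hs0 hs1 x z) =
      ∫ τ in (0 : ℝ)..t, (-⟪Y τ, x⟫_ℝ + M * (∫ r in (0 : ℝ)..τ, ⟪Y r, x⟫_ℝ) +
        ⟪forcing u τ, energyEmbedding hs0 hs1 x⟫_ℝ) := by
  have hform : ∀ τ ∈ Icc 0 T, form s (y τ) (energyEmbedding hs0 hs1 x) = ⟪Y τ, x⟫_ℝ := by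
    intro τ hτ
    rw [hy τ hτ, form_energyEmbedding]
  refine intervalIntegral.integral_congr_ae ?_
  have hne : ∀ᵐ τ : ℝ, τ ≠ T := Measure.ae_ne volume T
  filter_upwards [ae_inner_forcing hω u, hne] with τ h1 h2 hτ
  rw [uIoc_of_le ht.1] at hτ
  have hτT : τ ∈ Icc 0 T := ⟨hτ.1.le, hτ.2.trans ht.2⟩
  have hτo : τ ∈ Ioo 0 T := ⟨hτ.1, lt_of_le_of_ne hτT.2 h2⟩
  have h3 : ∫ r in (0 : ℝ)..τ, form s (y r) (energyEmbedding hs0 hs1 x) =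
      ∫ r in (0 : ℝ)..τ, ⟪Y r, x⟫_ℝ := by
    refine intervalIntegral.integral_congr fun r hr => ?_
    rw [uIcc_of_le hτT.1] at hr
    exact hform r ⟨hr.1, hr.2.trans hτT.2⟩
  rw [hform τ hτT, h3, h1]
  simp only [indicator_movingSet_eq u hτo]

/-- A weak solution in the energy space is a solution, with velocity as time derivative. -/
theorem isSolution_of_isWeakSolution (hs0 : 0 < s) (hs1 : s < 1) (hT : 0 < T) (hω : IsOpen ω₀)
    (u : Control T ω₀ c) {y₀ : energySpace s} {y₁ : L2} {Y : ℝ → energySpace s} {W : ℝ → L2}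
    [CompleteSpace (energySpace s)]
    (h : IsWeakSolution (energyEmbedding hs0 hs1) T M (forcing u) y₀ y₁ Y W) :
    IsSolution s T M c ω₀ (energyEmbedding hs0 hs1 y₀) y₁ u
        (fun t => energyEmbedding hs0 hs1 (Y t)) ∧
      ∀ t ∈ Icc 0 T, timeDeriv T (fun t => energyEmbedding hs0 hs1 (Y t)) t = W t := by
  set S := energyEmbedding hs0 hs1 with hS
  have h0T : (0 : ℝ) ∈ Icc 0 T := left_mem_Icc.2 hT.le
  have hWi : Continuous fun t => W (projIcc 0 T hT.le t) :=
    h.cont_vel.comp_continuous (continuous_subtype_val.comp continuous_projIcc)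
      fun t => (projIcc 0 T hT.le t).2
  have hWp : ∀ t ∈ Icc 0 T, W (projIcc 0 T hT.le t) = W t := fun t ht => by
    rw [projIcc_of_mem hT.le ht]
  -- `F` continues the solution to a `C¹` function on `ℝ`
  set F : ℝ → L2 := fun t => S y₀ + ∫ τ in (0 : ℝ)..t, W (projIcc 0 T hT.le τ) with hF
  have hFd : ∀ t, HasDerivAt F (W (projIcc 0 T hT.le t)) t := fun t =>
    (intervalIntegral.integral_hasDerivAt_right (hWi.intervalIntegrable 0 t)
      (hWi.stronglyMeasurableAtFilter _ _) hWi.continuousAt).const_add _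
  have hSF : EqOn (fun t => S (Y t)) F (Icc 0 T) := by
    intro t ht
    simp only [hF, h.pos t ht]
    congr 1
    refine intervalIntegral.integral_congr fun τ hτ => (hWp τ ?_).symm
    rw [uIcc_of_le ht.1] at hτ
    exact ⟨hτ.1, hτ.2.trans ht.2⟩
  have hder : ∀ t ∈ Icc 0 T, timeDeriv T (fun t => S (Y t)) t = W t := by
    intro t ht
    rw [timeDeriv, derivWithin_congr hSF (hSF ht),
      (hFd t).hasDerivWithinAt.derivWithin (uniqueDiffOn_Icc hT t ht), hWp t ht]
  have hFc : ContDiff ℝ 1 F := by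
    rw [contDiff_one_iff_deriv]
    refine ⟨fun t => (hFd t).differentiableAt, ?_⟩
    have : deriv F = fun t => W (projIcc 0 T hT.le t) := funext fun t => (hFd t).deriv
    rw [this]
    exact hWi
  have hY0 : S (Y 0) = S y₀ := by
    rw [h.pos 0 h0T, intervalIntegral.integral_same, add_zero]
  refine ⟨⟨⟨fun t _ => energyEmbedding_mem hs0 hs1 _, fun t₀ ht₀ => ?_⟩,
    hFc.contDiffOn.congr hSF, hY0, ?_, fun v hv t ht => ?_⟩, hder⟩
  · have h1 := tendsto_iff_norm_sub_tendsto_zero.1 (h.cont_pos t₀ ht₀)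
    refine h1.congr fun t => ?_
    rw [← map_sub, energyNorm_energyEmbedding]
  · rw [hder 0 h0T]
    -- at `t = 0` the equation tests `W 0 - y₁` only with the dense subspace `H_0^s`
    have hperp : W 0 - y₁ = 0 := by
      refine eq_zero_of_forall_inner_H0s hs0 hs1 fun v hv => ?_
      have h1 := h.vel (toEnergy (⟨v, hv⟩ : H0sSubmodule s)) 0 h0T
      rw [energyEmbedding_toEnergy, intervalIntegral.integral_same, add_zero] at h1
      rw [inner_sub_left, h1, sub_self]
    exact sub_eq_zero.1 hperp
  · have h1 := h.vel (toEnergy (⟨v, hv⟩ : H0sSubmodule s)) t ht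
    rw [← weak_rhs_eq hs0 hs1 hω u (fun τ _ => rfl) _ ht, energyEmbedding_toEnergy] at h1
    rw [hder t ht]
    exact h1

theorem exists_isWeakSolution_of_isSolution (hs0 : 0 < s) (hs1 : s < 1) (hT : 0 < T)
    (hω : IsOpen ω₀) (u : Control T ω₀ c) {y₀ : energySpace s} {y₁ : L2} {y : ℝ → L2}
    (h : IsSolution s T M c ω₀ (energyEmbedding hs0 hs1 y₀) y₁ u y) :
    ∃ Y : ℝ → energySpace s, (∀ t ∈ Icc 0 T, y t = energyEmbedding hs0 hs1 (Y t)) ∧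
      IsWeakSolution (energyEmbedding hs0 hs1) T M (forcing u) y₀ y₁ Y (timeDeriv T y) := by
  set S := energyEmbedding hs0 hs1 with hS
  have hex : ∀ t, ∃ x : energySpace s, t ∈ Icc 0 T → y t = S x := by
    intro t
    by_cases ht : t ∈ Icc 0 T
    · exact ⟨toEnergy (⟨y t, h.energy.1 t ht⟩ : H0sSubmodule s), fun _ =>
        (energyEmbedding_toEnergy hs0 hs1 ⟨y t, h.energy.1 t ht⟩).symm⟩
    · exact ⟨0, fun h => absurd h ht⟩
  choose Y hY using hex
  have huniq := uniqueDiffOn_Icc hT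
  have hdc : ContinuousOn (timeDeriv T y) (Icc 0 T) :=
    h.smooth.continuousOn_derivWithin huniq le_rfl
  refine ⟨Y, hY, fun t₀ ht₀ => ?_, hdc, fun t ht => ?_, fun v t ht => ?_⟩
  · refine tendsto_iff_norm_sub_tendsto_zero.2 ((h.energy.2 t₀ ht₀).congr' ?_)
    filter_upwards [self_mem_nhdsWithin] with t ht
    rw [hY t ht, hY t₀ ht₀, ← map_sub, energyNorm_energyEmbedding]
  · have hsub : Icc 0 t ⊆ Icc 0 T := Icc_subset_Icc_right ht.2
    have h1 := intervalIntegral.integral_eq_sub_of_hasDeriv_right_of_le ht.1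
      (h.smooth.continuousOn.mono hsub) (f' := timeDeriv T y) (fun x hx => by
        have hxT : x ∈ Ioo 0 T := ⟨hx.1, hx.2.trans_le ht.2⟩
        have hd :=
          (h.smooth.differentiableOn one_ne_zero x (Ioo_subset_Icc_self hxT)).hasDerivWithinAt
        exact (hd.hasDerivAt (Icc_mem_nhds hxT.1 hxT.2)).hasDerivWithinAt)
      ((hdc.mono (by rwa [uIcc_of_le ht.1])).intervalIntegrable)
    rw [h1, ← hY t ht, h.init]
    abel
  · rw [← weak_rhs_eq hs0 hs1 hω u hY v ht]
    exact h.weak _ (energyEmbedding_mem hs0 hs1 v) t ht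

end FracWave

end

theorem theorem1p2 (T M : ℝ) (hT : 0 < T) :
    ∃ C : ℝ, 0 < C ∧
      ∀ s : ℝ, 0 < s → s < 1 →
      ∀ (c : ℝ) (ω₀ : Set ℝ), IsOpen ω₀ → ω₀.Nonempty → ω₀ ⊆ FracWave.dom →
      ∀ y₀ ∈ FracWave.H0s s, ∀ (y₁ : FracWave.L2) (u : FracWave.Control T ω₀ c),
        ∃ y : ℝ → FracWave.L2,
          FracWave.IsSolution s T M c ω₀ y₀ y₁ u y ∧
          (∀ z : ℝ → FracWave.L2, FracWave.IsSolution s T M c ω₀ y₀ y₁ u z →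
            Set.EqOn z y (Set.Icc 0 T)) ∧
          ∀ t ∈ Set.Icc 0 T,
            FracWave.energyNorm s (y t) + ‖y t‖ + ‖FracWave.timeDeriv T y t‖ ≤
              C * (FracWave.energyNorm s y₀ + ‖y₁‖ + ‖u‖) := by
  obtain ⟨K, hK, hpoincare⟩ := FracWave.exists_norm_le_energyMap
  have hG := growthConst_pos T M
  refine ⟨(2 + K) * √(growthConst T M), by positivity,
    fun s hs0 hs1 c ω₀ hω _ _ y₀ hy₀ y₁ u => ?_⟩
  have hcomplete := FracWave.completeSpace_energySpace hs0 hs1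
  set S := FracWave.energyEmbedding hs0 hs1 with hS
  have hadj : Function.Injective (ContinuousLinearMap.adjoint S) := by
    rw [injective_iff_map_eq_zero]
    intro x hx
    refine FracWave.eq_zero_of_forall_inner_H0s hs0 hs1 fun v hv => ?_
    have h1 := FracWave.energyEmbedding_toEnergy hs0 hs1
      (⟨v, hv⟩ : FracWave.H0sSubmodule s)
    change inner ℝ x ((⟨v, hv⟩ : FracWave.H0sSubmodule s) : FracWave.L2) = 0
    rw [← h1, ← ContinuousLinearMap.adjoint_inner_left, ← hS, hx, inner_zero_left]
  obtain ⟨ι, e, g, σ, hσ, hdiag⟩ := exists_singular_value_decomposition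
    (FracWave.isCompactOperator_energyEmbedding hs0 hs1)
    (FracWave.energyEmbedding_injective hs0 hs1) hadj
  have hfm : ∀ v : FracWave.L2, IntervalIntegrable
      (fun τ => inner ℝ (FracWave.forcing u τ) v) volume 0 T :=
    fun v => FracWave.integrable_inner_forcing hω u v T
  have hfsq : IntervalIntegrable (fun τ => ‖FracWave.forcing u τ‖ ^ 2) volume 0 T :=
    (FracWave.integrable_norm_forcing_sq hω u).intervalIntegrable
  obtain ⟨x₀, hx₀⟩ : ∃ x₀, S x₀ = y₀ := ⟨FracWave.toEnergy (⟨y₀, hy₀⟩ : FracWave.H0sSubmodule s),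
    FracWave.energyEmbedding_toEnergy hs0 hs1 _⟩
  subst hx₀
  obtain ⟨Y, W, hYW⟩ := exists_isWeakSolution hσ hdiag hT.le M hfm hfsq x₀ y₁
  obtain ⟨hsol, hder⟩ := FracWave.isSolution_of_isWeakSolution hs0 hs1 hT hω u hYW
  refine ⟨fun t => S (Y t), hsol, fun z hz t ht => ?_, fun t ht => ?_⟩
  · obtain ⟨Z, hZ, hZw⟩ :=
      FracWave.exists_isWeakSolution_of_isSolution hs0 hs1 hT hω u hz
    rw [hZ t ht, hZw.eqOn hσ hdiag hfm hYW ht]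
  · rw [hder t ht, FracWave.energyNorm_energyEmbedding, FracWave.energyNorm_energyEmbedding]
    have hle := hYW.sq_norm_add_le hσ hdiag hT.le hfm hfsq ht
    have hf := FracWave.integral_norm_forcing_sq_le hT.le hω u
    set R := ‖x₀‖ + ‖y₁‖ + ‖u‖ with hR
    have hR0 : 0 ≤ R := by positivity
    have hsq : ‖Y t‖ ^ 2 + ‖W t‖ ^ 2 ≤ growthConst T M * R ^ 2 := by
      refine hle.trans (mul_le_mul_of_nonneg_left ?_ hG.le)
      have := norm_nonneg x₀
      have := norm_nonneg y₁
      have := norm_nonneg u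
      nlinarith [mul_nonneg (norm_nonneg x₀) (norm_nonneg y₁),
        mul_nonneg (norm_nonneg x₀) (norm_nonneg u), mul_nonneg (norm_nonneg y₁) (norm_nonneg u)]
    have hroot : √(growthConst T M * R ^ 2) = √(growthConst T M) * R := by
      rw [Real.sqrt_mul hG.le, Real.sqrt_sq hR0]
    have hY : ‖Y t‖ ≤ √(growthConst T M) * R := by
      rw [← hroot]
      exact Real.le_sqrt_of_sq_le (by nlinarith [sq_nonneg ‖W t‖])
    have hW : ‖W t‖ ≤ √(growthConst T M) * R := by
      rw [← hroot]
      exact Real.le_sqrt_of_sq_le (by nlinarith [sq_nonneg ‖Y t‖])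
    have hSY : ‖S (Y t)‖ ≤ K * ‖Y t‖ := by
      obtain ⟨v, hv⟩ := FracWave.exists_toEnergy_eq (Y t)
      rw [← hv, hS, FracWave.energyEmbedding_toEnergy]
      exact hpoincare s hs0 hs1 v
    calc ‖Y t‖ + ‖S (Y t)‖ + ‖W t‖ ≤ √(growthConst T M) * R + K * (√(growthConst T M) * R) +
          √(growthConst T M) * R := by
          gcongr
          exact hSY.trans (by gcongr)
      _ = _ := by ring
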